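/- Let $A=S^1\times[0,1]$ be an oriented annulus with core curve $\gamma$, and fix $\epsilon_0>0$. A metric $\rho$ on $A$ is called \emph{regular} if $(A,\rho)$ is isometric to the quotient of a closed neighborhood $\{p\in\mathbb H^2: d_{\mathbb H^2}(p,G)\le r\}$, $r>0$, of a geodesic $G$ of $\mathbb H^2$ by a hyperbolic isometry with axis $G$. For $\epsilon>0$ let $U_\epsilon(A)$ be the set of regular metrics on $A$ for which the core has length at most $\epsilon$ and each component of $\partial A$ has length $\epsilon_0$. Let $\mathcal C(A,\partial A)$ be the set of homotopy classes of homotopically non-trivial simple loops in $A$ and of simple arcs in $A$ with endpoints on $\partial A$ that are not homotopic into $\partial A$ with fixed endpoints (free homotopy for loops, homotopy with fixed endpoints for arcs), let $l_\rho(\beta)$ be the length of the $\rho$-geodesic representative of $\beta$, and define $$d_{L(A)}(\rho_1,\rho_2)=\sup_{\beta\in\mathcal C(A,\partial A)}\left|\log\frac{l_{\rho_1}(\beta)}{l_{\rho_2}(\beta)}\right|.$$ Fix a simple arc $\omega$ in $A$ connecting the two components of $\partial A$. For $\rho\in U_\epsilon(A)$, lift the $\rho$-geodesic representative of $\omega$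 to the universal cover of $(A,\rho)$ in $\mathbb H^2$ and extend it to a complete geodesic; let $p_L,p_R$ be the orthogonal projections to the lift $\tilde\gamma$ of $\gamma$ of its ideal endpoints on the left and on the right of the oriented geodesic $\tilde\gamma$. The twist parameter of $\rho$ is $tw_\rho(A)=\pm d_{\mathbb H^2}(p_L,p_R)/l_\rho(\gamma)$, with the sign $+$ if the direction from $p_L$ to $p_R$ agrees with the orientation of $\tilde\gamma$, and $-$ otherwise. \textbf{Lemma.} Let $0<\epsilon<\epsilon_0$ and $\epsilon<1$. There is a constant $c$, depending only on $\epsilon_0$ and $\epsilon$, such that the following holds for every such $\omega$ and all $\rho_1,\rho_2\in U_\epsilon(A)$. Put $t_i=tw_{\rho_i}(A)$ and $l_i=l_{\rho_i}(\gamma)$, and assume $l_1\le l_2$. Then $d_{L(A)}(\rho_1,\rho_2)$ is finite, and: (i) if $|t_1-t_2|\,l_1\le\log(1/l_1)$, then $$\left|d_{L(A)}(\rho_1,\rho_2)-\log\frac{l_2}{l_1}\right|\le c;$$ (ii) if $|t_1-t_2|\,l_1>\log(1/l_1)$, then $$\left|d_{L(A)}(\rho_1,\rho_2)-\log\frac{|t_1-t_2|\,l_2}{\log(1/l_1)}\right|\le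 c, \qquad\text{where}\qquad \log\frac{|t_1-t_2|\,l_2}{\log(1/l_1)}=\log\frac{l_2}{l_1}+\log\frac{|t_1-t_2|\,l_1}{\log(1/l_1)}.$$ -/

import Mathlib

open scoped UpperHalfPlane

noncomputable section

namespace Annular

/-- The (oriented, compact) annulus `A = S¹ × [0, 1]`. -/
abbrev Annulus : Type := UnitAddCircle × unitInterval

/-- The boundary `∂A`, with components `S¹ × {0}` and `S¹ × {1}`. -/
def boundary : Set Annulus := {a | a.2 = 0 ∨ a.2 = 1}

/-- The universal covering `ℝ × [0, 1] → A`. -/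
def cover (u : ℝ × unitInterval) : Annulus := ((u.1 : UnitAddCircle), u.2)

/-! ### Hyperbolic plane: the geodesic `G` and its neighbourhoods -/

/-- The geodesic `G` of `ℍ` from `0` to `∞`. -/
def axis : Set ℍ := {z | z.re = 0}

/-- The closed `r`-neighbourhood `{z | d(z, G) ≤ r}` of `G`. -/
def nbhd (r : ℝ) : Set ℍ := {z | Metric.infDist z axis ≤ r}

/-- The geodesic of `ℍ` with ideal endpoints `a < b` in `ℝ`: a Euclidean half-circle. -/
def geodesic (a b : ℝ) : Set ℍ := {z | ‖(z : ℂ) - (((a + b) / 2 : ℝ) : ℂ)‖ = (b - a) / 2}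

/-- The orthogonal projection to `G` of the ideal point `x ≠ 0`: the geodesic from `-x` to `x`
is the one that is perpendicular to `G` and ends at `x`, and it meets `G` in `i |x|`. -/
def idealProj (x : ℝ) (hx : x ≠ 0) : ℍ := ⟨⟨0, |x|⟩, abs_pos.mpr hx⟩

/-! ### Regular metrics -/

/-- An isometry of `(A, ρ)` with the quotient of `{z | d(z, G) ≤ r}` by the hyperbolic isometry
`z ↦ exp ℓ * z` with axis `G`, given by its lift `dev` to the universal covers. The quotient
carries the distance between orbits. The lift is normalized by the orientation: the circle
direction of `A` is the upward direction of `G`, with `S¹ × {0}` on its left and `S¹ × {1}` on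
its right. (Such a lift can always be so normalized, by a rotation of `ℍ` that reverses `G`
and by the reflection in `G`; that boundary goes to boundary is automatic.) -/
structure Development (ρ : Annulus → Annulus → ℝ) where
  ℓ : ℝ
  ℓ_pos : 0 < ℓ
  r : ℝ
  r_pos : 0 < r
  dev : (ℝ × unitInterval) ≃ₜ nbhd r
  equivariant : ∀ (x : ℝ) (s : unitInterval),
    ((dev (x + 1, s) : ℍ) : ℂ) = (Real.exp ℓ : ℂ) * ((dev (x, s) : ℍ) : ℂ)
  left : ∀ x : ℝ, (dev (x, 0) : ℍ).re < 0 ∧ Metric.infDist (dev (x, 0) : ℍ) axis = r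
  right : ∀ x : ℝ, 0 < (dev (x, 1) : ℍ).re ∧ Metric.infDist (dev (x, 1) : ℍ) axis = r
  isometry : ∀ u v : ℝ × unitInterval,
    ρ (cover u) (cover v) = ⨅ n : ℤ, dist (dev u : ℍ) (dev (v.1 + n, v.2) : ℍ)

/-- `ρ` is (the distance function of) a regular metric on `A`. -/
def IsRegular (ρ : Annulus → Annulus → ℝ) : Prop := Nonempty (Development ρ)

/-- The `ρ`-length of a curve: the supremum of the lengths of inscribed polygons
(the same formula as `eVariationOn`). -/
def length (ρ : Annulus → Annulus → ℝ) (c : unitInterval → Annulus) : ENNReal :=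
  ⨆ p : ℕ × {u : ℕ → unitInterval // Monotone u},
    ∑ i ∈ Finset.range p.1, ENNReal.ofReal (ρ (c (p.2.1 i)) (c (p.2.1 (i + 1))))

/-- A closed curve, traversed once as a path. -/
def loopPath (f : C(UnitAddCircle, Annulus)) (t : unitInterval) : Annulus :=
  f ((t : ℝ) : UnitAddCircle)

/-- The circle at height `s`, parametrized by the circle direction. -/
def circleAt (s : unitInterval) : C(UnitAddCircle, Annulus) :=
  ⟨fun x => (x, s), by fun_prop⟩

/-- `l_ρ(β)` for the homotopy class of an arc `β` (homotopies fix the endpoints): the length of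
a shortest arc in the class, which is its geodesic representative. -/
def arcLength (ρ : Annulus → Annulus → ℝ) (β : C(unitInterval, Annulus)) : ℝ :=
  (⨅ (β' : C(unitInterval, Annulus)) (_ : β.HomotopicRel β' {0, 1}), length ρ β').toReal

/-- `l_ρ(f)` for the free homotopy class of a loop `f`: the length of a shortest loop
in the class, which is its geodesic representative. -/
def loopLength (ρ : Annulus → Annulus → ℝ) (f : C(UnitAddCircle, Annulus)) : ℝ :=
  (⨅ (g : C(UnitAddCircle, Annulus)) (_ : f.Homotopic g), length ρ (loopPath g)).toReal

/-- `l_ρ(γ)`, the length of the core `γ` of `A`. -/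
def coreLength (ρ : Annulus → Annulus → ℝ) : ℝ :=
  loopLength ρ (circleAt ⟨1 / 2, by norm_num, by norm_num⟩)

/-- `U_ε(A)`: the regular metrics on `A` for which each component of `∂A` has length `ε₀` and
the core has length at most `ε`. -/
def regularMetrics (ε₀ ε : ℝ) : Set (Annulus → Annulus → ℝ) :=
  {ρ | IsRegular ρ ∧
    length ρ (loopPath (circleAt 0)) = ENNReal.ofReal ε₀ ∧
    length ρ (loopPath (circleAt 1)) = ENNReal.ofReal ε₀ ∧
    coreLength ρ ≤ ε}

/-! ### The distance `d_{L(A)}` -/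

/-- Simple essential arcs of `(A, ∂A)`: embedded arcs with endpoints on `∂A` that cannot be
homotoped into `∂A` with fixed endpoints. -/
def IsEssentialArc (β : C(unitInterval, Annulus)) : Prop :=
  Function.Injective β ∧ β 0 ∈ boundary ∧ β 1 ∈ boundary ∧
    ¬ ∃ β' : C(unitInterval, Annulus), β.HomotopicRel β' {0, 1} ∧ ∀ t, β' t ∈ boundary

/-- Non-trivial simple loops of `A`. -/
def IsEssentialLoop (f : C(UnitAddCircle, Annulus)) : Prop :=
  Function.Injective f ∧ ¬ f.Nullhomotopic

/-- The numbers `|log (l_ρ₁(β) / l_ρ₂(β))|` for `β ∈ 𝒞(A, ∂A)`. -/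
def logRatios (ρ₁ ρ₂ : Annulus → Annulus → ℝ) : Set ℝ :=
  {x | (∃ β, IsEssentialArc β ∧ x = |Real.log (arcLength ρ₁ β / arcLength ρ₂ β)|) ∨
    (∃ f, IsEssentialLoop f ∧ x = |Real.log (loopLength ρ₁ f / loopLength ρ₂ f)|)}

/-- `d_{L(A)}(ρ₁, ρ₂)`. -/
def lipDist (ρ₁ ρ₂ : Annulus → Annulus → ℝ) : ℝ := sSup (logRatios ρ₁ ρ₂)

/-! ### The twist parameter -/

/-- Simple arcs that connect the two components of `∂A`. -/
def IsReferenceArc (ω : C(unitInterval, Annulus)) : Prop :=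
  Function.Injective ω ∧ (ω 0).2 = 0 ∧ (ω 1).2 = 1

/-- `t` is the twist parameter `tw_ρ(A)` with respect to the reference arc `ω`: lift `ω` to the
universal cover of `(A, ρ)` in `ℍ`, let `a` (on the left of `G`) and `b` (on the right) be the
ideal endpoints of the complete geodesic that extends the geodesic with the same endpoints as
the lift, and let `p_L`, `p_R` be the orthogonal projections of `a`, `b` to `G`. Then `t` is
`d(p_L, p_R) / l_ρ(γ)`, with the sign `+` if `p_R` lies above `p_L` on the upward oriented `G`
and `-` if it lies below. -/
def HasTwist (ρ : Annulus → Annulus → ℝ) (ω : C(unitInterval, Annulus)) (t : ℝ) : Prop :=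
  ∃ (D : Development ρ) (w : C(unitInterval, ℝ × unitInterval)),
    (∀ s, cover (w s) = ω s) ∧
    ∃ (a b : ℝ) (ha : a < 0) (hb : 0 < b),
      (D.dev (w 0) : ℍ) ∈ geodesic a b ∧ (D.dev (w 1) : ℍ) ∈ geodesic a b ∧
      t = (if (idealProj a ha.ne).im ≤ (idealProj b hb.ne').im then 1 else -1) *
        (dist (idealProj a ha.ne) (idealProj b hb.ne') / coreLength ρ)

end Annular

end

open scoped UpperHalfPlane
noncomputable section
namespace Annular

/-! The development places the universal cover in Fermi coordinates: height `u` along the axis and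
signed distance `v` from it. The deck transformation adds `ℓ` to `u`, and `cosh_dist_fermi` controls
all distances.

An essential arc joins the two boundary components, so its lift has endpoints with `v = ±r` at
heights `f` (left) and `g` (right). Its length is at least `|g - f|` and at least `2 r`. A detour
along the axis shows that it is at most `3 (r + |g - f|)`, so it is comparable to `r + |g - f|`.
Boundary length `ε₀` forces `cosh r` to be comparable to `1 / ℓ`, hence `r` to `log (1 / ℓ)`; here
`ε < ε₀` and `ε < 1` keep both quantities away from `0`. Since `tanh r` is bounded below, passing
from the ideal endpoints to the boundary endpoints changes the displacement by a bounded amount.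
Thus `g - f` is `ℓ (n + t)` up to a bounded error, where the real number `n` is the winding relative
to `ω`. The result is `exists_arcLength_bound`: the arc length is comparable to `log (1 / ℓ) + ℓ |n
+ t|`.

A loop of degree `k` has length `|k| ℓ` (`loopLength_eq`), so loops contribute only `log (l₂ / l₁)`.
For arcs, `comparison_aux` bounds the ratios in both directions by a constant times the larger of
`l₂ / l₁` and `|t₁ - t₂| l₂ / log (1 / l₁)`; the two cases of the theorem say which is larger. The
core attains the first quantity. The arc with `n = -t₁` nearly attains the second: it is about as
short as possible for `ρ₁`, while for `ρ₂` it has twist `|t₁ - t₂|` to undo. Multiplicative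
constants become the additive `c` after taking logarithms. -/

/-! ### Fermi coordinates along the axis -/

/-- The point of `ℍ` at signed distance `v` from the axis (positive on the right) whose
orthogonal projection to the axis is `i exp u`. -/
def fermi (u v : ℝ) : ℍ :=
  ⟨⟨Real.exp u * (Real.sinh v / Real.cosh v), Real.exp u / Real.cosh v⟩,
    div_pos (Real.exp_pos u) (Real.cosh_pos v)⟩

/-- The height of the orthogonal projection to the axis, in arc length. -/
def heightCoord (z : ℍ) : ℝ := Real.log ‖(z : ℂ)‖

/-- The signed distance to the axis. -/
def sideCoord (z : ℍ) : ℝ := Real.arsinh (z.re / z.im)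

theorem fermi_re (u v : ℝ) : (fermi u v).re = Real.exp u * (Real.sinh v / Real.cosh v) := rfl

theorem fermi_im (u v : ℝ) : (fermi u v).im = Real.exp u / Real.cosh v := rfl

theorem normSq_eq (z : ℍ) : ‖(z : ℂ)‖ ^ 2 = z.re ^ 2 + z.im ^ 2 := by
  rw [← Complex.normSq_eq_norm_sq, Complex.normSq_apply]
  simp [sq]

theorem norm_fermi (u v : ℝ) : ‖(fermi u v : ℂ)‖ = Real.exp u := by
  have h := normSq_eq (fermi u v)
  have hc := (Real.cosh_pos v).ne'
  have h2 : (fermi u v).re ^ 2 + (fermi u v).im ^ 2 = Real.exp u ^ 2 := by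
    rw [fermi_re, fermi_im]
    field_simp
    rw [Real.cosh_sq v]
  rw [h2] at h
  exact (pow_left_inj₀ (norm_nonneg _) (Real.exp_pos u).le two_ne_zero).1 h

theorem heightCoord_fermi (u v : ℝ) : heightCoord (fermi u v) = u := by
  rw [heightCoord, norm_fermi, Real.log_exp]

theorem sideCoord_fermi (u v : ℝ) : sideCoord (fermi u v) = v := by
  rw [sideCoord, fermi_re, fermi_im, ← Real.arsinh_sinh v]
  congr 1
  have hc := (Real.cosh_pos v).ne'
  have he := (Real.exp_pos u).ne'
  rw [Real.arsinh_sinh]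
  field_simp

theorem norm_coe_pos (z : ℍ) : 0 < ‖(z : ℂ)‖ := norm_pos_iff.2 z.ne_zero

theorem fermi_coords (z : ℍ) : fermi (heightCoord z) (sideCoord z) = z := by
  have hn := norm_coe_pos z
  have hsq := normSq_eq z
  have him := z.im_pos
  have hc : Real.cosh (sideCoord z) = ‖(z : ℂ)‖ / z.im := by
    rw [sideCoord, Real.cosh_arsinh]
    have : 1 + (z.re / z.im) ^ 2 = (‖(z : ℂ)‖ / z.im) ^ 2 := by
      field_simp
      linarith
    rw [this, Real.sqrt_sq (by positivity)]
  apply UpperHalfPlane.ext_re_im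
  · rw [fermi_re, heightCoord, Real.exp_log hn, hc, sideCoord, Real.sinh_arsinh]
    field_simp
  · rw [fermi_im, heightCoord, Real.exp_log hn, hc]
    field_simp

theorem continuous_heightCoord : Continuous heightCoord :=
  (UpperHalfPlane.continuous_coe.norm).log fun z => (norm_coe_pos z).ne'

theorem cosh_dist_fermi (u v u' v' : ℝ) : Real.cosh (dist (fermi u v) (fermi u' v')) =
    Real.cosh v * Real.cosh v' * Real.cosh (u - u') - Real.sinh v * Real.sinh v' := by
  rw [UpperHalfPlane.cosh_dist, Complex.dist_eq, ← Complex.normSq_eq_norm_sq,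
    Complex.normSq_apply]
  simp only [Complex.sub_re, Complex.sub_im, UpperHalfPlane.coe_re, UpperHalfPlane.coe_im,
    fermi_re, fermi_im]
  have hc := (Real.cosh_pos v).ne'
  have hc' := (Real.cosh_pos v').ne'
  have he := (Real.exp_pos u).ne'
  have he' := (Real.exp_pos u').ne'
  have h1 := Real.cosh_sq v
  have h2 := Real.cosh_sq v'
  rw [Real.cosh_eq (u - u'), neg_sub, Real.exp_sub, Real.exp_sub]
  field_simp
  generalize Real.cosh v = C at *
  generalize Real.cosh v' = C' at *
  generalize Real.sinh v = S at *
  generalize Real.sinh v' = S' at *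
  generalize Real.exp u = a at *
  generalize Real.exp u' = b at *
  have h1' : S ^ 2 = C ^ 2 - 1 := by linarith
  have h2' : S' ^ 2 = C' ^ 2 - 1 := by linarith
  linear_combination (C' ^ 2 * a ^ 2) * h1' + (C ^ 2 * b ^ 2) * h2'

theorem cosh_dist_fermi_same_side (u u' v : ℝ) :
    Real.cosh (dist (fermi u v) (fermi u' v)) =
      1 + Real.cosh v ^ 2 * (Real.cosh (u - u') - 1) := by
  rw [cosh_dist_fermi]
  linear_combination Real.cosh_sq v

/-- With `d` the height difference, the hyperbolic cosine of the distance is `cosh v cosh v' (cosh d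
- 1) + cosh (v - v')`. The product is at least `1` and so is the last term, so projecting to the
axis does not increase distances. -/
theorem abs_heightCoord_sub_le_dist (z w : ℍ) :
    |heightCoord z - heightCoord w| ≤ dist z w := by
  rw [← abs_of_nonneg (dist_nonneg (x := z) (y := w)), ← Real.cosh_le_cosh]
  conv_rhs => rw [← fermi_coords z, ← fermi_coords w]
  rw [cosh_dist_fermi]
  generalize heightCoord z - heightCoord w = d
  generalize sideCoord z = v
  generalize sideCoord w = v'
  have h1 := Real.one_le_cosh (v - v')
  rw [Real.cosh_sub] at h1
  have h2 : 1 ≤ Real.cosh v * Real.cosh v' :=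
    one_le_mul_of_one_le_of_one_le (Real.one_le_cosh v) (Real.one_le_cosh v')
  nlinarith [mul_nonneg (sub_nonneg.2 h2) (sub_nonneg.2 (Real.one_le_cosh d))]

theorem abs_sideCoord_sub_le_dist (z w : ℍ) : |sideCoord z - sideCoord w| ≤ dist z w := by
  rw [← abs_of_nonneg (dist_nonneg (x := z) (y := w)), ← Real.cosh_le_cosh]
  conv_rhs => rw [← fermi_coords z, ← fermi_coords w]
  rw [cosh_dist_fermi, Real.cosh_sub]
  have h2 : 0 < Real.cosh (sideCoord z) * Real.cosh (sideCoord w) :=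
    mul_pos (Real.cosh_pos _) (Real.cosh_pos _)
  nlinarith [mul_nonneg h2.le
    (sub_nonneg.2 (Real.one_le_cosh (heightCoord z - heightCoord w)))]

theorem dist_fermi_same_height (u v v' : ℝ) : dist (fermi u v) (fermi u v') = |v - v'| := by
  rw [← abs_of_nonneg (dist_nonneg (x := fermi u v) (y := fermi u v'))]
  apply le_antisymm <;> rw [← Real.cosh_le_cosh, cosh_dist_fermi, Real.cosh_sub v, sub_self,
    Real.cosh_zero, mul_one]

theorem dist_fermi_axis (u u' : ℝ) : dist (fermi u 0) (fermi u' 0) = |u - u'| := by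
  rw [← abs_of_nonneg (dist_nonneg (x := fermi u 0) (y := fermi u' 0))]
  apply le_antisymm <;> rw [← Real.cosh_le_cosh, cosh_dist_fermi_same_side, Real.cosh_zero] <;>
    linarith

/-- The half-angle form of the chord formula for an equidistant curve. It compares chords with the
length element `cosh v du` in both directions. -/
theorem sinh_half_dist_fermi (u u' v : ℝ) : Real.sinh (dist (fermi u v) (fermi u' v) / 2) =
    Real.cosh v * Real.sinh (|u - u'| / 2) := by
  have h := cosh_dist_fermi_same_side u u' v
  have hx := Real.cosh_two_mul (dist (fermi u v) (fermi u' v) / 2)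
  have hy := Real.cosh_two_mul (|u - u'| / 2)
  rw [mul_div_cancel₀ _ two_ne_zero, Real.cosh_sq] at hx hy
  rw [Real.cosh_abs] at hy
  have h0 : 0 ≤ Real.sinh (dist (fermi u v) (fermi u' v) / 2) :=
    Real.sinh_nonneg_iff.2 (by positivity)
  have h1 : 0 ≤ Real.sinh (|u - u'| / 2) := Real.sinh_nonneg_iff.2 (by positivity)
  refine (pow_left_inj₀ h0 (mul_nonneg (Real.cosh_pos v).le h1) two_ne_zero).1 ?_
  rw [mul_pow]
  rw [hx, hy] at h
  linarith

theorem mul_sinh_le_sinh_mul {c x : ℝ} (hc : 1 ≤ c) (hx : 0 ≤ x) :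
    c * Real.sinh x ≤ Real.sinh (c * x) := by
  have hd : ∀ y, HasDerivAt (fun y => Real.sinh (c * y) - c * Real.sinh y)
      (Real.cosh (c * y) * c - c * Real.cosh y) y := fun y => by
    have h1 : HasDerivAt (fun y => Real.sinh (c * y)) (Real.cosh (c * y) * c) y := by
      simpa using ((hasDerivAt_id y).const_mul c).sinh
    exact h1.sub ((Real.hasDerivAt_sinh y).const_mul c)
  have hm : MonotoneOn (fun y => Real.sinh (c * y) - c * Real.sinh y) (Set.Ici 0) := by
    refine monotoneOn_of_deriv_nonneg (convex_Ici 0)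
      (fun y _ => (hd y).continuousAt.continuousWithinAt)
      (fun y _ => (hd y).differentiableAt.differentiableWithinAt) fun y hy => ?_
    rw [interior_Ici, Set.mem_Ioi] at hy
    rw [(hd y).deriv]
    have : Real.cosh y ≤ Real.cosh (c * y) := by
      rw [Real.cosh_le_cosh, abs_of_pos hy, abs_of_pos (by positivity)]
      nlinarith
    nlinarith
  have := hm (Set.mem_Ici.2 le_rfl) (Set.mem_Ici.2 hx) hx
  simpa using this

theorem dist_fermi_same_side_le (u u' v : ℝ) :
    dist (fermi u v) (fermi u' v) ≤ Real.cosh v * |u - u'| := by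
  have h := mul_sinh_le_sinh_mul (Real.one_le_cosh v) (by positivity : 0 ≤ |u - u'| / 2)
  rw [← sinh_half_dist_fermi, Real.sinh_le_sinh] at h
  linarith

theorem mem_axis_iff (z : ℍ) : z ∈ axis ↔ z = fermi (heightCoord z) 0 := by
  constructor
  · intro h
    have h : z.re = 0 := h
    conv_lhs => rw [← fermi_coords z]
    rw [sideCoord, h, zero_div, Real.arsinh_zero]
  · intro h
    rw [h, axis, Set.mem_ofPred_eq, fermi_re]
    simp

/-- The foot of the perpendicular is the axis point of the same height, and no axis point is nearer
because the signed distance is 1-Lipschitz. -/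
theorem infDist_axis (z : ℍ) : Metric.infDist z axis = |sideCoord z| := by
  have hm : fermi (heightCoord z) 0 ∈ axis := by
    rw [mem_axis_iff, heightCoord_fermi]
  apply le_antisymm
  · refine (Metric.infDist_le_dist_of_mem hm).trans ?_
    conv_lhs => rw [← fermi_coords z]
    rw [heightCoord_fermi, dist_fermi_same_height, sub_zero]
  · refine (Metric.le_infDist ⟨_, hm⟩).2 fun w hw => ?_
    rw [mem_axis_iff] at hw
    have := abs_sideCoord_sub_le_dist z w
    rwa [hw, sideCoord_fermi, sub_zero, ← hw] at this

theorem fermi_mem_nbhd {u v r : ℝ} (h : |v| ≤ r) : fermi u v ∈ nbhd r := by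
  rwa [nbhd, Set.mem_ofPred_eq, infDist_axis, sideCoord_fermi]

theorem sideCoord_neg_iff (z : ℍ) : sideCoord z < 0 ↔ z.re < 0 := by
  rw [sideCoord, Real.arsinh_neg_iff, div_lt_iff₀ z.im_pos, zero_mul]

theorem sideCoord_pos_iff (z : ℍ) : 0 < sideCoord z ↔ 0 < z.re := by
  rw [sideCoord, Real.arsinh_pos_iff, lt_div_iff₀ z.im_pos, zero_mul]

theorem coords_of_coe_eq {z w : ℍ} {a : ℝ}
    (h : (w : ℂ) = (Real.exp a : ℂ) * (z : ℂ)) :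
    heightCoord w = heightCoord z + a ∧ sideCoord w = sideCoord z := by
  constructor
  · rw [heightCoord, heightCoord, h, norm_mul, Complex.norm_real, Real.norm_eq_abs,
      abs_of_pos (Real.exp_pos a), Real.log_mul (Real.exp_pos a).ne' (norm_coe_pos z).ne',
      Real.log_exp, add_comm]
  · have hre : w.re = Real.exp a * z.re := by
      rw [← UpperHalfPlane.coe_re, h, Complex.re_ofReal_mul, UpperHalfPlane.coe_re]
    have him : w.im = Real.exp a * z.im := by
      rw [← UpperHalfPlane.coe_im, h, Complex.im_ofReal_mul, UpperHalfPlane.coe_im]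
    rw [sideCoord, sideCoord, hre, him, mul_div_mul_left _ _ (Real.exp_pos a).ne']

theorem continuous_fermi : Continuous fun p : ℝ × ℝ => fermi p.1 p.2 := by
  rw [UpperHalfPlane.isEmbedding_coe.continuous_iff]
  have : (fun p : ℝ × ℝ => ((fermi p.1 p.2 : ℍ) : ℂ)) = fun p =>
      ((Real.exp p.1 * (Real.sinh p.2 / Real.cosh p.2) : ℝ) : ℂ) +
        ((Real.exp p.1 / Real.cosh p.2 : ℝ) : ℂ) * Complex.I := by
    funext p
    apply Complex.ext <;> simp [fermi_re, fermi_im, -Complex.ofReal_mul, -Complex.ofReal_div]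
  change Continuous (fun p : ℝ × ℝ => ((fermi p.1 p.2 : ℍ) : ℂ))
  rw [this]
  have hc : ∀ p : ℝ × ℝ, Real.cosh p.2 ≠ 0 := fun p => (Real.cosh_pos _).ne'
  fun_prop (disch := exact hc)

/-! ### Lifts to the universal covering -/

theorem continuous_cover : Continuous cover := by
  unfold cover
  exact ((AddCircle.isCoveringMap_coe (1 : ℝ)).continuous.comp continuous_fst).prodMk
    continuous_snd

theorem cover_add_int (x : ℝ) (n : ℤ) (s : unitInterval) : cover (x + n, s) = cover (x, s) := by
  have : ((x + n : ℝ) : UnitAddCircle) = (x : UnitAddCircle) := by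
    rw [← sub_eq_zero, ← AddCircle.coe_sub, AddCircle.coe_eq_zero_iff]
    exact ⟨n, by simp⟩
  simp only [cover, this]

theorem cover_eq_cover_iff {u v : ℝ × unitInterval} :
    cover u = cover v ↔ ∃ n : ℤ, v = (u.1 + n, u.2) := by
  constructor
  · intro h
    have h1 : (u.1 : UnitAddCircle) = (v.1 : UnitAddCircle) := congrArg Prod.fst h
    have h2 : u.2 = v.2 := congrArg (fun a : Annulus => a.2) h
    rw [eq_comm, ← sub_eq_zero, ← AddCircle.coe_sub, AddCircle.coe_eq_zero_iff] at h1
    obtain ⟨n, hn⟩ := h1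
    refine ⟨n, Prod.ext ?_ h2.symm⟩
    simp only [zsmul_eq_mul, mul_one] at hn
    simp only [hn]
    ring
  · rintro ⟨n, rfl⟩
    exact (cover_add_int _ _ _).symm

/-- Only the circle factor has to be lifted; the `[0, 1]` coordinate is carried along. -/
theorem exists_lift_of_simplyConnected {X : Type*} [TopologicalSpace X] [SimplyConnectedSpace X]
    [LocallyPathConnectedSpace X] (F : C(X, Annulus)) :
    ∃ G : C(X, ℝ × unitInterval), ∀ x, cover (G x) = F x := by
  obtain ⟨x₀⟩ : Nonempty X := inferInstance
  obtain ⟨e, he⟩ := QuotientAddGroup.mk_surjective (F x₀).1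
  obtain ⟨g, ⟨-, hg⟩, -⟩ := (AddCircle.isCoveringMap_coe (1 : ℝ)).existsUnique_continuousMap_lifts
    ((ContinuousMap.fst : C(Annulus, UnitAddCircle)).comp F) x₀ e he
  refine ⟨⟨fun x => (g x, (F x).2), by fun_prop⟩, fun x => Prod.ext ?_ rfl⟩
  exact congrFun hg x

theorem exists_lift_path (β : C(unitInterval, Annulus)) :
    ∃ w : C(unitInterval, ℝ × unitInterval), ∀ s, cover (w s) = β s := by
  obtain ⟨G, hG⟩ := exists_lift_of_simplyConnected
    (⟨fun x : ℝ => β (Set.projIcc 0 1 zero_le_one x),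
      β.continuous.comp continuous_projIcc⟩ : C(ℝ, Annulus))
  refine ⟨⟨fun s => G s, by fun_prop⟩, fun s => (hG s).trans ?_⟩
  simp

/-- Two lifts of the same map differ by a deck transformation. -/
theorem exists_int_of_lifts {X : Type*} [TopologicalSpace X] [PreconnectedSpace X]
    {G G' : X → ℝ × unitInterval} (hG : Continuous G) (hG' : Continuous G')
    (h : ∀ x, cover (G x) = cover (G' x)) : ∃ n : ℤ, ∀ x, G' x = ((G x).1 + n, (G x).2) := by
  rcases isEmpty_or_nonempty X with hX | ⟨⟨x₀⟩⟩
  · exact ⟨0, fun x => (hX.false x).elim⟩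
  choose n hn using fun x => cover_eq_cover_iff.1 (h x)
  have hc : Continuous n := by
    rw [Int.isClosedEmbedding_coe_real.continuous_iff]
    have : ((fun m : ℤ => (m : ℝ)) ∘ n) = fun x => (G' x).1 - (G x).1 := by
      funext x
      have := congrArg Prod.fst (hn x)
      simp only [Function.comp] at this ⊢
      linarith
    change Continuous ((fun m : ℤ => (m : ℝ)) ∘ n)
    rw [this]
    fun_prop
  refine ⟨n x₀, fun x => ?_⟩
  rw [hn x, PreconnectedSpace.constant inferInstance hc (x := x) (y := x₀)]

/-- The homotopy is extended to `ℝ × ℝ` by clamping and lifted there. Along the fixed endpoints the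
lift covers a constant path, so it is constant; a deck transformation then matches its initial path
with `w`. -/
theorem exists_lift_of_homotopicRel {β β' : C(unitInterval, Annulus)}
    (h : β.HomotopicRel β' {0, 1}) {w : C(unitInterval, ℝ × unitInterval)}
    (hw : ∀ s, cover (w s) = β s) :
    ∃ w' : C(unitInterval, ℝ × unitInterval),
      (∀ s, cover (w' s) = β' s) ∧ w' 0 = w 0 ∧ w' 1 = w 1 := by
  obtain ⟨H⟩ := h
  let q : ℝ → unitInterval := Set.projIcc 0 1 zero_le_one
  have hq : Continuous q := continuous_projIcc
  have hqc : ∀ t : unitInterval, q t = t := fun t => Set.projIcc_val _ t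
  obtain ⟨G, hG⟩ := exists_lift_of_simplyConnected
    (⟨fun x : ℝ × ℝ => H (q x.1, q x.2), by fun_prop⟩ : C(ℝ × ℝ, Annulus))
  have hG' : ∀ s t : unitInterval, cover (G (s, t)) = H (s, t) := fun s t => by
    rw [hG]
    simp [hqc]
  have hend : ∀ s, ∀ t ∈ ({0, 1} : Set unitInterval), H (s, t) = β t := fun s t ht =>
    H.eq_fst s ht
  have hvert : ∀ t ∈ ({0, 1} : Set unitInterval),
      G ((1 : unitInterval), t) = G ((0 : unitInterval), t) := fun t ht => by
    obtain ⟨n, hn⟩ := exists_int_of_lifts (X := unitInterval)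
      (G := fun _ => G (((0 : unitInterval) : ℝ), (t : ℝ))) (G' := fun s => G (s, t))
      continuous_const (by fun_prop) fun s => by rw [hG', hG', hend _ t ht, hend _ t ht]
    rw [hn 1, ← hn 0]
  obtain ⟨n, hn⟩ := exists_int_of_lifts (X := unitInterval)
    (G := fun t => G (((0 : unitInterval) : ℝ), (t : ℝ))) (G' := w) (by fun_prop) w.continuous
    fun t => by rw [hG', hw, H.apply_zero]
  refine ⟨⟨fun t => ((G (((1 : unitInterval) : ℝ), (t : ℝ))).1 + n,
    (G (((1 : unitInterval) : ℝ), (t : ℝ))).2), by fun_prop⟩, fun t => ?_, ?_, ?_⟩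
  · refine (cover_add_int _ _ _).trans ?_
    rw [Prod.mk.eta, hG', H.apply_one]
  · rw [hn]
    simp only [ContinuousMap.coe_mk]
    rw [hvert 0 (by simp)]
  · rw [hn]
    simp only [ContinuousMap.coe_mk]
    rw [hvert 1 (by simp)]

/-! ### Homotopies from convexity of the strip -/

/-- Straight-line interpolation in `ℝ × [0, 1]`. -/
def interpolate (t : unitInterval) (u v : ℝ × unitInterval) : ℝ × unitInterval :=
  ((1 - (t : ℝ)) * u.1 + t * v.1,
    Set.projIcc 0 1 zero_le_one ((1 - (t : ℝ)) * u.2 + t * v.2))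

theorem continuous_interpolate : Continuous fun p : unitInterval ×
    (ℝ × unitInterval) × (ℝ × unitInterval) => interpolate p.1 p.2.1 p.2.2 := by
  unfold interpolate
  exact Continuous.prodMk (by fun_prop) (continuous_projIcc.comp (by fun_prop))

theorem interpolate_zero (u v : ℝ × unitInterval) : interpolate 0 u v = u := by
  simp [interpolate]

theorem interpolate_one (u v : ℝ × unitInterval) : interpolate 1 u v = v := by
  simp [interpolate]

theorem interpolate_self (t : unitInterval) (u : ℝ × unitInterval) : interpolate t u u = u := by
  have h : ∀ x : ℝ, (1 - (t : ℝ)) * x + t * x = x := fun x => by ring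
  simp [interpolate, h]

theorem interpolate_add_int (t : unitInterval) (u v : ℝ × unitInterval) (k : ℤ) :
    interpolate t (u.1 + k, u.2) (v.1 + k, v.2) =
      ((interpolate t u v).1 + k, (interpolate t u v).2) := by
  refine Prod.ext ?_ rfl
  simp only [interpolate]
  ring

theorem homotopicRel_of_lifts {β β' : C(unitInterval, Annulus)}
    {w w' : C(unitInterval, ℝ × unitInterval)} (hw : ∀ s, cover (w s) = β s)
    (hw' : ∀ s, cover (w' s) = β' s) (h0 : w 0 = w' 0) (h1 : w 1 = w' 1) :
    β.HomotopicRel β' {0, 1} := by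
  refine ⟨{ toFun := fun p => cover (interpolate p.1 (w p.2) (w' p.2))
            continuous_toFun := continuous_cover.comp (continuous_interpolate.comp
              (f := fun p : unitInterval × unitInterval => (p.1, w p.2, w' p.2)) (by fun_prop))
            map_zero_left := fun t => by rw [interpolate_zero, hw]
            map_one_left := fun t => by rw [interpolate_one, hw']
            prop' := fun t x hx => ?_ }⟩
  have hx' : w' x = w x := by
    rcases hx with rfl | rfl
    · exact h0.symm
    · exact h1.symm
  simp only [ContinuousMap.coe_mk, hx', interpolate_self, hw]

/-! ### Loops and their degree -/

/-- `F` is a lift of the loop `f`, and `k` is the degree of `f`. -/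
def IsLoopLift (f : C(UnitAddCircle, Annulus)) (F : ℝ → ℝ × unitInterval) (k : ℤ) : Prop :=
  Continuous F ∧ (∀ x : ℝ, cover (F x) = f (x : UnitAddCircle)) ∧
    ∀ x, F (x + 1) = ((F x).1 + k, (F x).2)

theorem exists_isLoopLift (f : C(UnitAddCircle, Annulus)) : ∃ F k, IsLoopLift f F k := by
  have hc : Continuous fun x : ℝ => f (x : UnitAddCircle) :=
    f.continuous.comp (AddCircle.isCoveringMap_coe (1 : ℝ)).continuous
  obtain ⟨G, hG⟩ := exists_lift_of_simplyConnected (⟨_, hc⟩ : C(ℝ, Annulus))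
  obtain ⟨k, hk⟩ := exists_int_of_lifts (G := G) (G' := fun x => G (x + 1)) G.continuous
    (by fun_prop) fun x => by
      rw [hG, hG]
      simp only [ContinuousMap.coe_mk]
      rw [AddCircle.coe_add_period]
  exact ⟨G, k, G.continuous, hG, hk⟩

theorem IsLoopLift.add_int {f : C(UnitAddCircle, Annulus)} {F : ℝ → ℝ × unitInterval} {k : ℤ}
    (h : IsLoopLift f F k) (x : ℝ) (n : ℤ) : F (x + n) = ((F x).1 + n * k, (F x).2) := by
  induction n using Int.induction_on with
  | zero => simp
  | succ n ih =>
    have := h.2.2 (x + n)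
    push_cast at ih ⊢
    rw [← add_assoc, this, ih]
    refine Prod.ext ?_ rfl
    simp only
    ring
  | pred n ih =>
    have := h.2.2 (x + (-n - 1 : ℤ))
    push_cast at ih this ⊢
    rw [show x + (-(n : ℝ) - 1) + 1 = x + -(n : ℝ) by ring, ih] at this
    refine Prod.ext ?_ (congrArg Prod.snd this).symm
    have := congrArg Prod.fst this
    simp only at this ⊢
    linarith

theorem isOpenQuotientMap_prodMap_coe :
    IsOpenQuotientMap (Prod.map id (fun x : ℝ => (x : UnitAddCircle)) :
      unitInterval × ℝ → unitInterval × UnitAddCircle) :=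
  IsOpenQuotientMap.id.prodMap QuotientAddGroup.isOpenQuotientMap_mk

/-- Equal degrees make the interpolation of the lifts commute with deck transformations, so it
descends to the annulus. -/
theorem IsLoopLift.homotopic {f g : C(UnitAddCircle, Annulus)} {F G : ℝ → ℝ × unitInterval}
    {k : ℤ} (hf : IsLoopLift f F k) (hg : IsLoopLift g G k) : f.Homotopic g := by
  have key : ∀ (t : unitInterval) (x y : ℝ), (x : UnitAddCircle) = (y : UnitAddCircle) →
      cover (interpolate t (F x) (G x)) = cover (interpolate t (F y) (G y)) := by
    intro t x y hxy
    have : cover (x, 0) = cover (y, 0) := Prod.ext hxy rfl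
    obtain ⟨n, hn⟩ := cover_eq_cover_iff.1 this
    have hy : y = x + n := congrArg Prod.fst hn
    rw [hy, hf.add_int, hg.add_int]
    have := interpolate_add_int t (F x) (G x) (n * k)
    push_cast at this
    rw [this]
    have := cover_add_int (interpolate t (F x) (G x)).1 (n * k) (interpolate t (F x) (G x)).2
    push_cast at this
    exact this.symm
  let K : unitInterval × UnitAddCircle → Annulus := fun p =>
    cover (interpolate p.1 (F p.2.out) (G p.2.out))
  have hK : ∀ (t : unitInterval) (x : ℝ),
      K (t, (x : UnitAddCircle)) = cover (interpolate t (F x) (G x)) := fun t x =>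
    key t _ _ (Quotient.out_eq _)
  -- `K` uses arbitrary representatives, so continuity is checked after pulling back along the open
  -- quotient map, where `hK` gives an explicit formula.
  have hcont : Continuous K := by
    rw [← isOpenQuotientMap_prodMap_coe.continuous_comp_iff]
    have : K ∘ (Prod.map id (fun x : ℝ => (x : UnitAddCircle))) =
        fun p : unitInterval × ℝ => cover (interpolate p.1 (F p.2) (G p.2)) :=
      funext fun p => hK p.1 p.2
    rw [this]
    have h1 := hf.1
    have h2 := hg.1
    exact continuous_cover.comp (continuous_interpolate.comp
      (f := fun p : unitInterval × ℝ => (p.1, F p.2, G p.2)) (by fun_prop))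
  refine ⟨{ toFun := K, continuous_toFun := hcont, map_zero_left := ?_, map_one_left := ?_ }⟩
  · intro x
    obtain ⟨x, rfl⟩ := QuotientAddGroup.mk_surjective x
    exact (hK 0 x).trans (by rw [interpolate_zero, hf.2.1])
  · intro x
    obtain ⟨x, rfl⟩ := QuotientAddGroup.mk_surjective x
    exact (hK 1 x).trans (by rw [interpolate_one, hg.2.1])

/-- Translating the lifted homotopy by one period changes it by a single integer, because `ℝ × ℝ` is
connected; the initial loop identifies this integer as `k`. -/
theorem IsLoopLift.exists_of_homotopic {f g : C(UnitAddCircle, Annulus)}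
    {F : ℝ → ℝ × unitInterval} {k : ℤ} (hf : IsLoopLift f F k) (h : f.Homotopic g) :
    ∃ G, IsLoopLift g G k := by
  obtain ⟨H⟩ := h
  let q : ℝ → unitInterval := Set.projIcc 0 1 zero_le_one
  have hq : Continuous q := continuous_projIcc
  have hqc : ∀ t : unitInterval, q t = t := fun t => Set.projIcc_val _ t
  have hcoe : Continuous fun x : ℝ => (x : UnitAddCircle) :=
    (AddCircle.isCoveringMap_coe (1 : ℝ)).continuous
  obtain ⟨G, hG⟩ := exists_lift_of_simplyConnected
    (⟨fun x : ℝ × ℝ => H (q x.1, (x.2 : UnitAddCircle)), by fun_prop⟩ : C(ℝ × ℝ, Annulus))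
  have hG' : ∀ (s : unitInterval) (x : ℝ), cover (G (s, x)) = H (s, (x : UnitAddCircle)) :=
    fun s t => by
      rw [hG]
      simp [hqc]
  obtain ⟨m, hm⟩ := exists_int_of_lifts (G := fun x : ℝ × ℝ => G x)
    (G' := fun x : ℝ × ℝ => G (x.1, x.2 + 1)) G.continuous (by fun_prop) fun x => by
      rw [hG, hG]
      simp only [ContinuousMap.coe_mk]
      rw [AddCircle.coe_add_period]
  obtain ⟨n, hn⟩ := exists_int_of_lifts (G := F)
    (G' := fun x => G (((0 : unitInterval) : ℝ), x)) hf.1 (by fun_prop) fun x => by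
      rw [hG', hf.2.1, H.apply_zero]
  have hmk : m = k := by
    have h1 := congrArg Prod.fst (hm (((0 : unitInterval) : ℝ), 0))
    simp only [hn] at h1
    have h2 := congrArg Prod.fst (hf.2.2 0)
    simp only [h2] at h1
    have : (m : ℝ) = k := by linarith
    exact_mod_cast this
  refine ⟨fun x => G (((1 : unitInterval) : ℝ), x), by fun_prop, fun x => ?_, fun x => ?_⟩
  · rw [hG', H.apply_one]
  · rw [← hmk]
    exact hm (((1 : unitInterval) : ℝ), x)

theorem isLoopLift_const (u : ℝ × unitInterval) :
    IsLoopLift (ContinuousMap.const _ (cover u)) (fun _ => u) 0 :=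
  ⟨continuous_const, fun _ => rfl, fun x => by simp⟩

theorem isLoopLift_circleAt (s : unitInterval) : IsLoopLift (circleAt s) (fun x => (x, s)) 1 :=
  ⟨by fun_prop, fun _ => rfl, fun x => by simp⟩

/-! ### Essential loops and arcs -/

theorem IsLoopLift.degree_ne_zero {f : C(UnitAddCircle, Annulus)} {F : ℝ → ℝ × unitInterval}
    {k : ℤ} (hf : IsLoopLift f F k) (h : ¬ f.Nullhomotopic) : k ≠ 0 := by
  rintro rfl
  exact h ⟨_, hf.homotopic (isLoopLift_const (0, 0))⟩

theorem isEssentialLoop_circleAt (s : unitInterval) : IsEssentialLoop (circleAt s) := by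
  refine ⟨fun x y h => congrArg Prod.fst h, ?_⟩
  rintro ⟨a, ha⟩
  obtain ⟨G, hG⟩ := (isLoopLift_circleAt s).exists_of_homotopic ha
  obtain ⟨n, hn⟩ := exists_int_of_lifts (G := fun _ : ℝ => G 0) (G' := G) continuous_const hG.1
    fun x => by
      rw [hG.2.1, hG.2.1]
      simp
  have h1 := congrArg Prod.fst (hn 1)
  have h2 := congrArg Prod.fst (hn 0)
  have h3 := congrArg Prod.fst (hG.2.2 0)
  simp only [zero_add, Int.cast_one] at h1 h2 h3
  linarith

/-- The two endpoints of an essential arc lie on different boundary components. -/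
theorem IsEssentialArc.endpoints {β : C(unitInterval, Annulus)} (hβ : IsEssentialArc β) :
    ((β 0).2 = 0 ∧ (β 1).2 = 1) ∨ ((β 0).2 = 1 ∧ (β 1).2 = 0) := by
  obtain ⟨-, h0, h1, h⟩ := hβ
  have key : ∀ s : unitInterval, (s = 0 ∨ s = 1) → (β 0).2 = s → (β 1).2 = s → False := by
    intro s hs hs0 hs1
    obtain ⟨w, hw⟩ := exists_lift_path β
    have hsnd : ∀ t, (w t).2 = (β t).2 := fun t => by rw [← hw t]; rfl
    -- If both endpoints were at height `s`, flattening the lift to that height would push the arc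
    -- into the boundary with fixed endpoints.
    let w' : C(unitInterval, ℝ × unitInterval) := ⟨fun t => ((w t).1, s), by fun_prop⟩
    refine h ⟨⟨fun t => cover (w' t), continuous_cover.comp w'.continuous⟩, ?_, fun t => hs⟩
    refine homotopicRel_of_lifts hw (w' := w') (fun _ => rfl) ?_ ?_
    · exact Prod.ext rfl ((hsnd 0).trans hs0)
    · exact Prod.ext rfl ((hsnd 1).trans hs1)
  rcases h0 with h0 | h0 <;> rcases h1 with h1 | h1
  · exact (key 0 (.inl rfl) h0 h1).elim
  · exact .inl ⟨h0, h1⟩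
  · exact .inr ⟨h0, h1⟩
  · exact (key 1 (.inr rfl) h0 h1).elim

/-- The lift of the straight arc from `(x, 0)` to `(y, 1)`. -/
def straightLift (x y : ℝ) : C(unitInterval, ℝ × unitInterval) :=
  ⟨fun t => (x + (y - x) * t, t), by fun_prop⟩

/-- The straight arc from `(x, 0)` to `(y, 1)`. -/
def straightArc (x y : ℝ) : C(unitInterval, Annulus) :=
  ⟨fun t => cover (straightLift x y t), continuous_cover.comp (straightLift x y).continuous⟩

/-- Any arc homotopic to it with fixed endpoints still runs from height `0` to height `1`, so it
passes through `1 / 2` and leaves the boundary. -/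
theorem isEssentialArc_straightArc (x y : ℝ) : IsEssentialArc (straightArc x y) := by
  refine ⟨fun s t h => congrArg Prod.snd h, .inl rfl, .inr rfl, ?_⟩
  rintro ⟨β', hβ', hb⟩
  obtain ⟨w', hw', h0, h1⟩ := exists_lift_of_homotopicRel hβ' (w := straightLift x y)
    fun _ => rfl
  have hc : Continuous fun t => ((β' t).2 : ℝ) := by fun_prop
  have e0 : ((β' 0).2 : ℝ) = 0 := by
    rw [← hw' 0, h0]
    rfl
  have e1 : ((β' 1).2 : ℝ) = 1 := by
    rw [← hw' 1, h1]
    rfl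
  obtain ⟨t, ht⟩ := mem_range_of_exists_le_of_exists_ge hc ⟨0, by rw [e0]; norm_num⟩
    ⟨1, by rw [e1]; norm_num⟩ (c := (1 / 2 : ℝ))
  rcases hb t with h | h <;> simp only [h] at ht <;> norm_num at ht

theorem exists_loop_of_lift {F : ℝ → ℝ × unitInterval} {k : ℤ} (hF : Continuous F)
    (hk : ∀ x, F (x + 1) = ((F x).1 + k, (F x).2)) :
    ∃ g : C(UnitAddCircle, Annulus), IsLoopLift g F k := by
  have hp : Function.Periodic (fun x => cover (F x)) 1 := fun x => by
    simp only [hk]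
    exact cover_add_int _ _ _
  have hc : Continuous (hp.lift : UnitAddCircle → Annulus) :=
    continuous_coinduced_dom.2 (continuous_cover.comp hF)
  exact ⟨⟨_, hc⟩, hF, fun x => rfl, hk⟩

/-! ### A Lipschitz competitor path through the axis -/

theorem sinh_le_two_mul {x : ℝ} (h0 : 0 ≤ x) (h1 : x ≤ 1) : Real.sinh x ≤ 2 * x := by
  have ha := Real.abs_exp_sub_one_le (x := x) (by rwa [abs_of_nonneg h0])
  have hb := Real.abs_exp_sub_one_le (x := -x) (by rwa [abs_neg, abs_of_nonneg h0])
  rw [abs_neg, abs_of_nonneg h0] at hb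
  rw [abs_of_nonneg h0] at ha
  rw [Real.sinh_eq]
  linarith [(abs_le.1 ha).2, (abs_le.1 hb).1]

theorem dist_le_of_dist_le_of_dist_le {c : ℝ → ℍ} {K a b : ℝ}
    (h1 : ∀ s t, s ≤ t → t ≤ a → dist (c s) (c t) ≤ K * (t - s))
    (h2 : ∀ s t, a ≤ s → s ≤ t → t ≤ b → dist (c s) (c t) ≤ K * (t - s)) :
    ∀ s t, s ≤ t → t ≤ b → dist (c s) (c t) ≤ K * (t - s) := by
  intro s t hst htb
  rcases le_total t a with h | h
  · exact h1 s t hst h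
  rcases le_total a s with h' | h'
  · exact h2 s t h' hst htb
  have := dist_triangle (c s) (c a) (c t)
  linarith [h1 s a h' le_rfl, h2 a t le_rfl h htb]

/-- A path in `nbhd r` that goes from `fermi u v` perpendicularly to the axis, then along it, and
then perpendicularly to `fermi u' v'`. -/
theorem exists_path_via_axis (u v u' v' : ℝ) {r : ℝ} (hv : |v| ≤ r) (hv' : |v'| ≤ r) :
    ∃ c : ℝ → ℍ, Continuous c ∧ c 0 = fermi u v ∧ c 3 = fermi u' v' ∧ (∀ t, c t ∈ nbhd r) ∧
      ∀ s t, s ≤ t → dist (c s) (c t) ≤ (r + |u - u'|) * (t - s) := by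
  have hr : 0 ≤ r := (abs_nonneg v).trans hv
  -- Clamping to `[0, 1]` lets one formula describe the three segments, traversed on `[0, 1]`, `[1,
  -- 2]` and `[2, 3]`.
  let q : ℝ → ℝ := fun x => max 0 (min 1 x)
  have hq : Continuous q := by fun_prop
  have hq0 : ∀ x, x ≤ 0 → q x = 0 := fun x hx => max_eq_left ((min_le_right _ _).trans hx)
  have hq1 : ∀ x, 1 ≤ x → q x = 1 := fun x hx => by simp [q, min_eq_left hx]
  have hq01 : ∀ x, 0 ≤ q x ∧ q x ≤ 1 := fun x =>
    ⟨le_max_left _ _, max_le zero_le_one (min_le_left _ _)⟩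
  have hql : ∀ s t, |q s - q t| ≤ |s - t| := fun s t => by
    have h1 := abs_max_sub_max_le_abs (min 1 s) (min 1 t) 0
    have h2 := abs_min_sub_min_le_max 1 s 1 t
    rw [sub_self, abs_zero, max_eq_right (abs_nonneg _)] at h2
    simp only [q, max_comm (0 : ℝ)]
    exact h1.trans h2
  have hlip : ∀ (a x : ℝ), |a| ≤ r + |u - u'| → ∀ s t : ℝ, s ≤ t →
      |a * q (s - x) - a * q (t - x)| ≤ (r + |u - u'|) * (t - s) := fun a x ha s t hst => by
    rw [← mul_sub, abs_mul]
    refine mul_le_mul ha ((hql _ _).trans ?_) (abs_nonneg _) (by positivity)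
    rw [abs_sub_comm, abs_of_nonneg (by linarith)]
    linarith
  let c : ℝ → ℍ := fun t => fermi (u + (u' - u) * q (t - 1)) (v * (1 - q t) + v' * q (t - 2))
  refine ⟨c, continuous_fermi.comp (f := fun t => (u + (u' - u) * q (t - 1),
    v * (1 - q t) + v' * q (t - 2))) (by fun_prop), ?_, ?_, fun t => fermi_mem_nbhd ?_, ?_⟩
  · simp only [c]
    rw [hq0 (0 - 1) (by norm_num), hq0 0 le_rfl, hq0 (0 - 2) (by norm_num)]
    simp
  · simp only [c]
    rw [hq1 (3 - 1) (by norm_num), hq1 3 (by norm_num), hq1 (3 - 2) (by norm_num)]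
    simp
  · rcases le_total t 2 with h | h
    · rw [hq0 (t - 2) (by linarith), mul_zero, add_zero, abs_mul v,
        abs_of_nonneg (sub_nonneg.2 (hq01 t).2)]
      nlinarith [hq01 t, abs_nonneg v]
    · rw [hq1 t (by linarith), sub_self, mul_zero, zero_add, abs_mul v', abs_of_nonneg (hq01 _).1]
      nlinarith [hq01 (t - 2), abs_nonneg v']
  · have h1 : ∀ s t, s ≤ t → t ≤ 1 → dist (c s) (c t) ≤ (r + |u - u'|) * (t - s) := by
      intro s t hst ht
      simp only [c]
      rw [hq0 (s - 1) (by linarith), hq0 (t - 1) (by linarith), hq0 (s - 2) (by linarith),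
        hq0 (t - 2) (by linarith), dist_fermi_same_height, abs_sub_comm]
      have := hlip v 0 (hv.trans (by linarith [abs_nonneg (u - u')])) s t hst
      rw [sub_zero, sub_zero] at this
      convert this using 2
      ring
    have h2 : ∀ s t, 1 ≤ s → s ≤ t → t ≤ 2 → dist (c s) (c t) ≤ (r + |u - u'|) * (t - s) := by
      intro s t hs hst ht
      simp only [c]
      rw [hq1 s (by linarith), hq1 t (by linarith), hq0 (s - 2) (by linarith),
        hq0 (t - 2) (by linarith)]
      simp only [sub_self, mul_zero, add_zero]
      rw [dist_fermi_axis]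
      have := hlip (u' - u) 1 (by rw [abs_sub_comm]; linarith) s t hst
      convert this using 2
      ring
    have h3 : ∀ s t, 2 ≤ s → s ≤ t → dist (c s) (c t) ≤ (r + |u - u'|) * (t - s) := by
      intro s t hs hst
      simp only [c]
      rw [hq1 (s - 1) (by linarith), hq1 (t - 1) (by linarith), hq1 s (by linarith),
        hq1 t (by linarith), dist_fermi_same_height]
      have := hlip v' 2 (hv'.trans (by linarith [abs_nonneg (u - u')])) s t hst
      convert this using 2
      ring
    intro s t hst
    exact dist_le_of_dist_le_of_dist_le (dist_le_of_dist_le_of_dist_le h1 h2)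
      (fun s t h h' _ => h3 s t h h') s t hst le_rfl

/-! ### Lengths measured through a development -/

namespace Development

variable {ρ : Annulus → Annulus → ℝ} (D : Development ρ)

theorem coords_dev_add_int (u : ℝ × unitInterval) (n : ℤ) :
    heightCoord (D.dev (u.1 + n, u.2)) = heightCoord (D.dev u) + n * D.ℓ ∧
      sideCoord (D.dev (u.1 + n, u.2)) = sideCoord (D.dev u) := by
  have step : ∀ x : ℝ, heightCoord (D.dev (x + 1, u.2)) = heightCoord (D.dev (x, u.2)) + D.ℓ ∧
      sideCoord (D.dev (x + 1, u.2)) = sideCoord (D.dev (x, u.2)) := fun x =>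
    coords_of_coe_eq (D.equivariant x u.2)
  induction n using Int.induction_on with
  | zero => simp
  | succ n ih =>
    have := step (u.1 + n)
    push_cast at ih ⊢
    rw [← add_assoc, this.1, this.2, ih.1, ih.2]
    exact ⟨by ring, rfl⟩
  | pred n ih =>
    have := step (u.1 + (-n - 1 : ℤ))
    push_cast at ih this ⊢
    rw [show u.1 + (-(n : ℝ) - 1) + 1 = u.1 + -(n : ℝ) by ring, ih.1, ih.2] at this
    exact ⟨by linarith [this.1], this.2.symm⟩

theorem abs_sideCoord_le (u : ℝ × unitInterval) : |sideCoord (D.dev u)| ≤ D.r := by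
  rw [← infDist_axis]
  exact (D.dev u).2

theorem sideCoord_left (x : ℝ) : sideCoord (D.dev (x, 0)) = -D.r := by
  obtain ⟨h1, h2⟩ := D.left x
  rw [infDist_axis, abs_of_neg ((sideCoord_neg_iff _).2 h1)] at h2
  linarith

theorem sideCoord_right (x : ℝ) : sideCoord (D.dev (x, 1)) = D.r := by
  obtain ⟨h1, h2⟩ := D.right x
  rwa [infDist_axis, abs_of_pos ((sideCoord_pos_iff _).2 h1)] at h2

theorem dev_ext {u v : ℝ × unitInterval}
    (h : heightCoord (D.dev u) = heightCoord (D.dev v))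
    (h' : sideCoord (D.dev u) = sideCoord (D.dev v)) : u = v := by
  apply D.dev.injective
  apply Subtype.ext
  rw [← fermi_coords (D.dev u), ← fermi_coords (D.dev v), h, h']

theorem continuous_coe_dev : Continuous fun u => (D.dev u : ℍ) :=
  continuous_subtype_val.comp D.dev.continuous

theorem continuous_height : Continuous fun u => heightCoord (D.dev u) :=
  continuous_heightCoord.comp D.continuous_coe_dev

theorem bddBelow_dists (u v : ℝ × unitInterval) :
    BddBelow (Set.range fun n : ℤ => dist (D.dev u : ℍ) (D.dev (v.1 + n, v.2) : ℍ)) :=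
  ⟨0, by rintro _ ⟨n, rfl⟩; exact dist_nonneg⟩

theorem rho_le_dist (u v : ℝ × unitInterval) :
    ρ (cover u) (cover v) ≤ dist (D.dev u : ℍ) (D.dev v : ℍ) := by
  rw [D.isometry]
  have := ciInf_le (D.bddBelow_dists u v) 0
  simpa using this

/-- At this range the heights differ by at most `ℓ / 2`, while a nontrivial deck transformation
moves them by at least `ℓ`; hence the infimum over the orbit is attained at `n = 0`. -/
theorem dist_le_rho {u v : ℝ × unitInterval}
    (h : dist (D.dev u : ℍ) (D.dev v : ℍ) ≤ D.ℓ / 2) :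
    dist (D.dev u : ℍ) (D.dev v : ℍ) ≤ ρ (cover u) (cover v) := by
  rw [D.isometry]
  refine le_ciInf fun n => ?_
  rcases eq_or_ne n 0 with rfl | hn
  · simp
  refine h.trans (le_trans ?_ (abs_heightCoord_sub_le_dist _ _))
  rw [(D.coords_dev_add_int v n).1]
  have h1 := (abs_heightCoord_sub_le_dist _ _).trans h
  have h2 : D.ℓ ≤ |(n : ℝ) * D.ℓ| := by
    rw [abs_mul, abs_of_pos D.ℓ_pos]
    have : (1 : ℝ) ≤ |(n : ℝ)| := by exact_mod_cast Int.one_le_abs hn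
    nlinarith [D.ℓ_pos]
  have h3 := abs_sub_abs_le_abs_sub ((n : ℝ) * D.ℓ)
    (heightCoord (D.dev u) - heightCoord (D.dev v))
  rw [abs_sub_comm (_ * _)] at h3
  rw [← sub_sub]
  linarith

theorem length_le {w : unitInterval → ℝ × unitInterval} {φ : unitInterval → ℝ}
    (h : ∀ s t, s ≤ t → dist (D.dev (w s) : ℍ) (D.dev (w t) : ℍ) ≤ φ t - φ s) :
    length ρ (fun s => cover (w s)) ≤ ENNReal.ofReal (φ 1 - φ 0) := by
  have hmono : Monotone φ := fun s t hst => 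
    sub_nonneg.1 (dist_nonneg.trans (h s t hst))
  refine iSup_le fun p => ?_
  obtain ⟨n, p, hp⟩ := p
  calc ∑ i ∈ Finset.range n, ENNReal.ofReal (ρ (cover (w (p i))) (cover (w (p (i + 1)))))
      ≤ ∑ i ∈ Finset.range n, ENNReal.ofReal (φ (p (i + 1)) - φ (p i)) :=
        Finset.sum_le_sum fun i _ => ENNReal.ofReal_le_ofReal
          ((D.rho_le_dist _ _).trans (h _ _ (hp i.le_succ)))
    _ = ENNReal.ofReal (φ (p n) - φ (p 0)) := by
        rw [← ENNReal.ofReal_sum_of_nonneg fun i _ => sub_nonneg.2 (hmono (hp i.le_succ)),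
          Finset.sum_range_sub fun i => φ (p i)]
    _ ≤ ENNReal.ofReal (φ 1 - φ 0) := by
        apply ENNReal.ofReal_le_ofReal
        linarith [hmono (unitInterval.le_one' (t := p n)), hmono (unitInterval.nonneg' (t := p 0))]

/-- A local lower bound suffices: by uniform continuity, an equal subdivision can be made so fine
that consecutive points satisfy both `h` and `dist_le_rho`, and then the increments of `φ`
telescope. -/
theorem le_length {w : unitInterval → ℝ × unitInterval} (hw : Continuous w)
    {φ : unitInterval → ℝ} {δ : ℝ} (hδ : 0 < δ)
    (h : ∀ s t, s ≤ t → dist (D.dev (w s) : ℍ) (D.dev (w t) : ℍ) ≤ δ →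
      φ t - φ s ≤ dist (D.dev (w s) : ℍ) (D.dev (w t) : ℍ)) :
    ENNReal.ofReal (φ 1 - φ 0) ≤ length ρ (fun s => cover (w s)) := by
  have huc := CompactSpace.uniformContinuous_of_continuous (D.continuous_coe_dev.comp hw)
  rw [Metric.uniformContinuous_iff] at huc
  obtain ⟨η, hη, huc⟩ := huc (min δ (D.ℓ / 2)) (lt_min hδ (by linarith [D.ℓ_pos]))
  obtain ⟨n, hn⟩ := exists_nat_one_div_lt hη
  have hN : (0 : ℝ) < (n : ℝ) + 1 := by positivity
  let p : ℕ → unitInterval := fun i => Set.projIcc 0 1 zero_le_one ((i : ℝ) / (n + 1))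
  have hp : Monotone p := fun i j hij => Set.monotone_projIcc _
    (div_le_div_of_nonneg_right (by exact_mod_cast hij) hN.le)
  have hp0 : p 0 = 0 := by
    simp only [p, Nat.cast_zero, zero_div]
    exact Set.projIcc_left _
  have hpn : p (n + 1) = 1 := by
    simp only [p, Nat.cast_add, Nat.cast_one, div_self hN.ne']
    exact Set.projIcc_right _
  have hstep : ∀ i, dist (p i) (p (i + 1)) < η := fun i => by
    refine lt_of_le_of_lt ?_ hn
    have h1 := abs_max_sub_max_le_abs (min 1 ((i : ℝ) / (n + 1)))
      (min 1 (((i + 1 : ℕ) : ℝ) / (n + 1))) 0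
    have h2 := abs_min_sub_min_le_max 1 ((i : ℝ) / (n + 1)) 1 (((i + 1 : ℕ) : ℝ) / (n + 1))
    rw [sub_self, abs_zero, max_eq_right (abs_nonneg _)] at h2
    have h3 : |(i : ℝ) / (n + 1) - ((i + 1 : ℕ) : ℝ) / (n + 1)| = 1 / (n + 1) := by
      rw [← sub_div, abs_div, abs_of_pos hN]
      push_cast
      simp
    rw [Subtype.dist_eq, Real.dist_eq]
    simp only [p, Set.coe_projIcc]
    rw [max_comm 0, max_comm 0]
    linarith
  have hsmall : ∀ i, dist (D.dev (w (p i)) : ℍ) (D.dev (w (p (i + 1))) : ℍ) <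
      min δ (D.ℓ / 2) := fun i => huc (hstep i)
  refine le_trans ?_ (le_iSup (fun p : ℕ × {u : ℕ → unitInterval // Monotone u} =>
    ∑ i ∈ Finset.range p.1,
      ENNReal.ofReal (ρ (cover (w (p.2.1 i))) (cover (w (p.2.1 (i + 1)))))) ⟨n + 1, p, hp⟩)
  have hsum : φ 1 - φ 0 ≤ ∑ i ∈ Finset.range (n + 1),
      ρ (cover (w (p i))) (cover (w (p (i + 1)))) := by
    rw [← hp0, ← hpn, ← Finset.sum_range_sub fun i => φ (p i)]
    refine Finset.sum_le_sum fun i _ => ?_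
    have := lt_min_iff.1 (hsmall i)
    exact (h _ _ (hp i.le_succ) this.1.le).trans (D.dist_le_rho this.2.le)
  refine (ENNReal.ofReal_le_ofReal hsum).trans (le_of_eq ?_)
  exact ENNReal.ofReal_sum_of_nonneg fun i _ =>
    dist_nonneg.trans (D.dist_le_rho (lt_min_iff.1 (hsmall i)).2.le)

theorem dist_le_length {w : unitInterval → ℝ × unitInterval} (hw : Continuous w) :
    ENNReal.ofReal (dist (D.dev (w 0) : ℍ) (D.dev (w 1) : ℍ)) ≤
      length ρ (fun s => cover (w s)) := by
  have := D.le_length hw (φ := fun t => dist (D.dev (w 0) : ℍ) (D.dev (w t) : ℍ)) one_pos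
    fun s t _ _ => by
      linarith [dist_triangle (D.dev (w 0) : ℍ) (D.dev (w s)) (D.dev (w t))]
  simpa using this

theorem exists_arc_le {β : C(unitInterval, Annulus)} {w : C(unitInterval, ℝ × unitInterval)}
    (hw : ∀ s, cover (w s) = β s) : ∃ β' : C(unitInterval, Annulus), β.HomotopicRel β' {0, 1} ∧
      length ρ β' ≤ ENNReal.ofReal
        (3 * (D.r + |heightCoord (D.dev (w 0)) - heightCoord (D.dev (w 1))|)) := by
  obtain ⟨c, hc, hc0, hc3, hmem, hlip⟩ := exists_path_via_axis (heightCoord (D.dev (w 0)))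
    (sideCoord (D.dev (w 0))) (heightCoord (D.dev (w 1))) (sideCoord (D.dev (w 1)))
    (D.abs_sideCoord_le _) (D.abs_sideCoord_le _)
  rw [fermi_coords] at hc0 hc3
  let w' : C(unitInterval, ℝ × unitInterval) :=
    ⟨fun t => D.dev.symm ⟨c (3 * t), hmem _⟩, D.dev.symm.continuous.comp (by fun_prop)⟩
  have hdev : ∀ t : unitInterval, (D.dev (w' t) : ℍ) = c (3 * t) := fun t => by simp [w']
  have hend : ∀ t : unitInterval, c (3 * t) = D.dev (w t) → w t = w' t := fun t ht => by
    apply D.dev.injective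
    apply Subtype.ext
    rw [hdev, ht]
  refine ⟨⟨fun t => cover (w' t), continuous_cover.comp w'.continuous⟩,
    homotopicRel_of_lifts hw (w' := w') (fun _ => rfl) (hend 0 ?_) (hend 1 ?_), ?_⟩
  · simpa using hc0
  · simpa using hc3
  · have := D.length_le (w := w') (φ := fun t =>
      3 * (D.r + |heightCoord (D.dev (w 0)) - heightCoord (D.dev (w 1))|) * t) fun s t hst => by
        rw [hdev, hdev]
        have hst' : (s : ℝ) ≤ t := hst
        refine (hlip _ _ (by linarith)).trans (le_of_eq ?_)
        ring
    simpa using this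

theorem arcLength_le {β : C(unitInterval, Annulus)} {w : C(unitInterval, ℝ × unitInterval)}
    (hw : ∀ s, cover (w s) = β s) : arcLength ρ β ≤
      3 * (D.r + |heightCoord (D.dev (w 0)) - heightCoord (D.dev (w 1))|) := by
  obtain ⟨β', h, hle⟩ := D.exists_arc_le hw
  refine ENNReal.toReal_le_of_le_ofReal ?_ ((iInf₂_le β' h).trans hle)
  have := D.r_pos
  positivity

theorem le_arcLength {β : C(unitInterval, Annulus)} {w : C(unitInterval, ℝ × unitInterval)}
    (hw : ∀ s, cover (w s) = β s) :
    dist (D.dev (w 0) : ℍ) (D.dev (w 1) : ℍ) ≤ arcLength ρ β := by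
  obtain ⟨β', h, hle⟩ := D.exists_arc_le hw
  -- Finiteness is essential, since `toReal` sends `⊤` to `0`; the path through the axis supplies a
  -- competitor of finite length.
  rw [arcLength, ← ENNReal.ofReal_le_iff_le_toReal
    (ne_top_of_le_ne_top ENNReal.ofReal_ne_top ((iInf₂_le β' h).trans hle))]
  refine le_iInf₂ fun β' h => ?_
  obtain ⟨w', hw', h0, h1⟩ := exists_lift_of_homotopicRel h hw
  have hβ' : (β' : unitInterval → Annulus) = fun s => cover (w' s) :=
    funext fun s => (hw' s).symm
  rw [hβ', ← h0, ← h1]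
  exact D.dist_le_length w'.continuous

theorem loopPath_eq {f : C(UnitAddCircle, Annulus)} {F : ℝ → ℝ × unitInterval} {k : ℤ}
    (h : IsLoopLift f F k) : loopPath f = fun t : unitInterval => cover (F t) :=
  funext fun t => (h.2.1 t).symm

/-- Winding `k` times along the axis gives the upper bound. Every homotopic loop has a lift whose
height changes by `k ℓ` in one period, which gives the lower bound. -/
theorem loopLength_eq {f : C(UnitAddCircle, Annulus)} {F : ℝ → ℝ × unitInterval} {k : ℤ}
    (hf : IsLoopLift f F k) : loopLength ρ f = |(k : ℝ)| * D.ℓ := by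
  have hmem : ∀ u, fermi u 0 ∈ nbhd D.r := fun u => fermi_mem_nbhd (by simpa using D.r_pos.le)
  let G : ℝ → ℝ × unitInterval := fun t => D.dev.symm ⟨fermi (k * D.ℓ * t) 0, hmem _⟩
  have hG : ∀ t, (D.dev (G t) : ℍ) = fermi (k * D.ℓ * t) 0 := fun t => by simp [G]
  have hGc : Continuous G := D.dev.symm.continuous.comp
    ((continuous_fermi.comp (f := fun t : ℝ => (k * D.ℓ * t, (0 : ℝ)))
      (by fun_prop)).subtype_mk _)
  obtain ⟨g, hg⟩ := exists_loop_of_lift hGc (k := k) fun x => by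
    have h := D.coords_dev_add_int (G x) k
    refine D.dev_ext ?_ ?_
    · rw [h.1, hG, hG, heightCoord_fermi, heightCoord_fermi]
      ring
    · rw [h.2, hG, hG, sideCoord_fermi, sideCoord_fermi]
  have hpos : 0 ≤ |(k : ℝ)| * D.ℓ := mul_nonneg (abs_nonneg _) D.ℓ_pos.le
  have hle : (⨅ (g : C(UnitAddCircle, Annulus)) (_ : f.Homotopic g), length ρ (loopPath g)) ≤
      ENNReal.ofReal (|(k : ℝ)| * D.ℓ) := by
    refine (iInf₂_le g (hf.homotopic hg)).trans ?_
    rw [loopPath_eq hg]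
    have := D.length_le (w := fun t : unitInterval => G t)
      (φ := fun t => |(k : ℝ)| * D.ℓ * t) fun s t hst => by
        have hst' : (s : ℝ) ≤ t := hst
        rw [hG, hG, dist_fermi_axis, ← mul_sub, abs_mul, abs_mul, abs_of_pos D.ℓ_pos,
          abs_sub_comm, abs_of_nonneg (sub_nonneg.2 hst'), mul_sub]
    simpa using this
  apply le_antisymm
  · exact ENNReal.toReal_le_of_le_ofReal hpos hle
  · rw [loopLength, ← ENNReal.ofReal_le_iff_le_toReal
      (ne_top_of_le_ne_top ENNReal.ofReal_ne_top hle)]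
    refine le_iInf₂ fun g hg => ?_
    obtain ⟨G, hG⟩ := hf.exists_of_homotopic hg
    rw [loopPath_eq hG]
    refine le_trans (ENNReal.ofReal_le_ofReal ?_)
      (D.dist_le_length (w := fun t : unitInterval => G t) (hG.1.comp continuous_subtype_val))
    refine le_trans ?_ (abs_heightCoord_sub_le_dist _ _)
    have h1 := hG.2.2 0
    rw [zero_add] at h1
    simp only [Set.Icc.coe_zero, Set.Icc.coe_one, h1, (D.coords_dev_add_int _ k).1]
    rw [sub_add_cancel_left, abs_neg, abs_mul, abs_of_pos D.ℓ_pos]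

theorem coreLength_eq : coreLength ρ = D.ℓ := by
  rw [coreLength, D.loopLength_eq (isLoopLift_circleAt _)]
  simp

theorem strictMono_height {s : unitInterval} {v : ℝ} (hs : ∀ x, sideCoord (D.dev (x, s)) = v) :
    StrictMono fun x => heightCoord (D.dev (x, s)) := by
  have hc : Continuous fun x => heightCoord (D.dev (x, s)) :=
    D.continuous_height.comp (by fun_prop)
  have hi : Function.Injective fun x => heightCoord (D.dev (x, s)) := fun x y h =>
    congrArg Prod.fst (D.dev_ext h ((hs x).trans (hs y).symm))
  refine (hc.strictMono_of_inj hi).resolve_right fun h => ?_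
  have h1 := h (zero_lt_one (α := ℝ))
  have h2 := (D.coords_dev_add_int (0, s) 1).1
  simp only [Int.cast_one, zero_add, one_mul] at h1 h2
  linarith [D.ℓ_pos]

/-- A monotone function that gains `ℓ` per unit step stays within `ℓ` of linear growth. Hence the
unknown parametrization of the boundary costs only a bounded error. -/
theorem abs_height_sub_le {s : unitInterval} {v : ℝ} (hs : ∀ x, sideCoord (D.dev (x, s)) = v)
    (x y : ℝ) : |heightCoord (D.dev (x, s)) - heightCoord (D.dev (y, s)) - D.ℓ * (x - y)| ≤
      D.ℓ := by
  have hm := (D.strictMono_height hs).monotone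
  have h1 := hm (show y + ⌊x - y⌋ ≤ x by linarith [Int.floor_le (x - y)])
  have h2 := hm (show x ≤ y + (⌊x - y⌋ + 1 : ℤ) by
    push_cast; linarith [Int.lt_floor_add_one (x - y)])
  have h3 := (D.coords_dev_add_int (y, s) ⌊x - y⌋).1
  have h4 := (D.coords_dev_add_int (y, s) (⌊x - y⌋ + 1)).1
  simp only at h1 h2 h3 h4
  rw [h3] at h1
  rw [h4] at h2
  push_cast at h2
  have h5 := mul_le_mul_of_nonneg_left (Int.floor_le (x - y)) D.ℓ_pos.le
  have h6 := mul_le_mul_of_nonneg_left (Int.lt_floor_add_one (x - y)).le D.ℓ_pos.le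
  rw [abs_le]
  constructor <;> linarith

theorem length_circleAt {s : unitInterval} {v : ℝ} (hs : ∀ x, sideCoord (D.dev (x, s)) = v) :
    length ρ (loopPath (circleAt s)) ≤ ENNReal.ofReal (Real.cosh v * D.ℓ) ∧
      ENNReal.ofReal (Real.cosh v * D.ℓ / 2) ≤ length ρ (loopPath (circleAt s)) := by
  have hm := (D.strictMono_height hs).monotone
  have hf : ∀ x, (D.dev (x, s) : ℍ) = fermi (heightCoord (D.dev (x, s))) v := fun x => by
    rw [← hs x, fermi_coords]
  have h1 := (D.coords_dev_add_int (0, s) 1).1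
  simp only [Int.cast_one, zero_add, one_mul] at h1
  rw [loopPath_eq (isLoopLift_circleAt s)]
  constructor
  · have := D.length_le (w := fun t => (t, s))
      (φ := fun t => Real.cosh v * heightCoord (D.dev (t, s))) fun x y hxy => by
        have hxy' : (x : ℝ) ≤ y := hxy
        have := dist_fermi_same_side_le (heightCoord (D.dev (x, s)))
          (heightCoord (D.dev (y, s))) v
        rw [← hf, ← hf, abs_sub_comm, abs_of_nonneg (sub_nonneg.2 (hm hxy'))] at this
        linarith
    convert this using 2
    simp only [Set.Icc.coe_zero, Set.Icc.coe_one, h1]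
    ring
  · have := D.le_length (w := fun t => (t, s)) (by fun_prop)
      -- The factor `1 / 2` pays for `sinh x ≤ 2 x`, valid on the short chords allowed by `δ = 1`.
      (φ := fun t => Real.cosh v * heightCoord (D.dev (t, s)) / 2) (δ := 1) one_pos
      fun x y hxy hd => by
        have hxy' : (x : ℝ) ≤ y := hxy
        have h := sinh_half_dist_fermi (heightCoord (D.dev (x, s)))
          (heightCoord (D.dev (y, s))) v
        rw [← hf, ← hf, abs_sub_comm, abs_of_nonneg (sub_nonneg.2 (hm hxy'))] at h
        have h2 := sinh_le_two_mul (x := dist (D.dev (x, s) : ℍ) (D.dev (y, s) : ℍ) / 2)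
          (by positivity) (by linarith)
        have h3 := Real.self_le_sinh_iff.2 (show 0 ≤ (heightCoord (D.dev (y, s)) -
          heightCoord (D.dev (x, s))) / 2 by linarith [hm hxy'])
        have h4 := mul_le_mul_of_nonneg_left h3 (Real.cosh_pos v).le
        linarith
    convert this using 2
    simp only [Set.Icc.coe_zero, Set.Icc.coe_one, h1]
    ring

end Development

/-! ### The twist parameter in Fermi coordinates -/

theorem idealProj_eq (x : ℝ) (hx : x ≠ 0) : idealProj x hx = fermi (Real.log |x|) 0 := by
  apply UpperHalfPlane.ext_re_im
  · rw [fermi_re]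
    simp [idealProj]
  · rw [fermi_im, Real.exp_log (abs_pos.2 hx)]
    simp [idealProj]

theorem sign_mul_dist_idealProj {a b : ℝ} (ha : a < 0) (hb : 0 < b) :
    (if (idealProj a ha.ne).im ≤ (idealProj b hb.ne').im then 1 else -1) *
      dist (idealProj a ha.ne) (idealProj b hb.ne') = Real.log b - Real.log (-a) := by
  have h1 : (idealProj a ha.ne).im = -a := abs_of_neg ha
  have h2 : (idealProj b hb.ne').im = b := abs_of_pos hb
  rw [h1, h2, idealProj_eq, idealProj_eq, dist_fermi_axis, abs_of_neg ha, abs_of_pos hb,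
    abs_sub_comm]
  split_ifs with h
  · rw [one_mul, abs_of_nonneg (sub_nonneg.2 (Real.log_le_log (by linarith) h))]
  · rw [abs_of_nonpos (sub_nonpos.2 (Real.log_le_log hb (by linarith)))]
    ring

theorem geodesic_equation {a b : ℝ} {z : ℍ} (hz : z ∈ geodesic a b) :
    ‖(z : ℂ)‖ ^ 2 - (a + b) * z.re + a * b = 0 := by
  have hz : ‖(z : ℂ) - (((a + b) / 2 : ℝ) : ℂ)‖ = (b - a) / 2 := hz
  have h := congrArg (· ^ 2) hz
  simp only [← Complex.normSq_eq_norm_sq, Complex.normSq_apply, Complex.sub_re, Complex.sub_im,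
    Complex.ofReal_re, Complex.ofReal_im, UpperHalfPlane.coe_re, UpperHalfPlane.coe_im] at h
  rw [normSq_eq]
  linear_combination h

/-- Put `s = (b + a) tanh r` and `P = -a b`. The geodesic equation makes `exp f` the positive root
of `X² + s X - P` and `exp g` that of `X² - s X - P`, so `exp g - exp f = s` and `exp f * exp g =
P`; dividing the first by twice the root of the second gives the claim. -/
theorem sinh_half_eq_of_mem_geodesic {a b f g r : ℝ} (ha : a < 0) (hb : 0 < b)
    (hf : fermi f (-r) ∈ geodesic a b) (hg : fermi g r ∈ geodesic a b) :
    Real.sinh ((g - f) / 2) =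
      Real.sinh r / Real.cosh r * Real.sinh ((Real.log b - Real.log (-a)) / 2) := by
  have h1 := geodesic_equation hf
  have h2 := geodesic_equation hg
  rw [norm_fermi, fermi_re, Real.sinh_neg, Real.cosh_neg, neg_div] at h1
  rw [norm_fermi, fermi_re] at h2
  generalize Real.sinh r / Real.cosh r = τ at *
  have split : ∀ x : ℝ, Real.exp x = Real.exp (x / 2) ^ 2 := fun x => by
    rw [← Real.exp_nat_mul]
    congr 1
    push_cast
    ring
  have hsinh : ∀ x y : ℝ, Real.sinh ((x - y) / 2) = (Real.exp (x / 2) ^ 2 - Real.exp (y / 2) ^ 2) /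
      (2 * (Real.exp (x / 2) * Real.exp (y / 2))) := fun x y => by
    have hx := (Real.exp_pos (x / 2)).ne'
    have hy := (Real.exp_pos (y / 2)).ne'
    rw [Real.sinh_eq, show -((x - y) / 2) = y / 2 - x / 2 by ring,
      show (x - y) / 2 = x / 2 - y / 2 by ring, Real.exp_sub, Real.exp_sub]
    field_simp
  rw [hsinh, hsinh]
  have hA : -a = Real.exp (Real.log (-a) / 2) ^ 2 := by
    rw [← split, Real.exp_log (by linarith)]
  have hB : b = Real.exp (Real.log b / 2) ^ 2 := by rw [← split, Real.exp_log hb]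
  have hA0 := Real.exp_pos (Real.log (-a) / 2)
  have hB0 := Real.exp_pos (Real.log b / 2)
  generalize Real.exp (Real.log (-a) / 2) = A at *
  generalize Real.exp (Real.log b / 2) = B at *
  rw [split f] at h1
  rw [split g] at h2
  have hx0 := Real.exp_pos (f / 2)
  have hy0 := Real.exp_pos (g / 2)
  generalize Real.exp (f / 2) = x at *
  generalize Real.exp (g / 2) = y at *
  obtain rfl : a = -A ^ 2 := by linarith
  subst hB
  have h3 : y ^ 2 - x ^ 2 = (B ^ 2 - A ^ 2) * τ := by
    have : (x ^ 2 + y ^ 2) * (y ^ 2 - x ^ 2 - (B ^ 2 - A ^ 2) * τ) = 0 := by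
      linear_combination h2 - h1
    rcases mul_eq_zero.1 this with h | h
    · nlinarith
    · linarith
  have h4 : y * x = B * A := by
    refine (pow_left_inj₀ (by positivity) (by positivity) two_ne_zero).1 ?_
    linear_combination h1 + x ^ 2 * h3
  rw [h3, h4]
  ring

/-- For `T ≥ 0` this rests on `sinh (T / 2 - c) ≤ exp (-c) * sinh (T / 2)`, so a factor between `exp
(-c)` and `1` moves the argument down by at most `c`. Negative `T` follows by oddness. -/
theorem abs_sub_le_of_sinh_eq {d T τ c : ℝ} (h : Real.sinh (d / 2) = τ * Real.sinh (T / 2))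
    (hτ : τ ≤ 1) (hc : Real.exp (-c) ≤ τ) : |T - d| ≤ 2 * c := by
  have hc0 : 0 ≤ c := by
    have := hc.trans hτ
    rw [Real.exp_le_one_iff] at this
    linarith
  have key : ∀ d T : ℝ, Real.sinh (d / 2) = τ * Real.sinh (T / 2) → 0 ≤ T → |T - d| ≤ 2 * c := by
    intro d T h hT
    have hs := Real.sinh_nonneg_iff.2 (show 0 ≤ T / 2 by linarith)
    have h1 : Real.sinh (d / 2) ≤ Real.sinh (T / 2) := by
      rw [h]
      nlinarith
    have h2 : Real.sinh (T / 2 - c) ≤ Real.sinh (d / 2) := by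
      refine le_trans ?_ (h ▸ mul_le_mul_of_nonneg_right hc hs)
      rw [Real.sinh_eq, Real.sinh_eq, show T / 2 - c = T / 2 + -c by ring, Real.exp_add,
        show -(T / 2 + -c) = -(T / 2) + c by ring, Real.exp_add]
      have h3 : Real.exp (-c) ≤ Real.exp c := Real.exp_le_exp.2 (by linarith)
      have h4 := mul_le_mul_of_nonneg_left h3 (Real.exp_pos (-(T / 2))).le
      linarith
    rw [Real.sinh_le_sinh] at h1 h2
    rw [abs_le]
    constructor <;> linarith
  rcases le_total 0 T with hT | hT
  · exact key d T h hT
  · have := key (-d) (-T) (by rw [neg_div, neg_div, Real.sinh_neg, Real.sinh_neg, h]; ring)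
      (by linarith)
    rwa [← neg_sub', abs_neg] at this

/-! ### Uniform estimates on `U_ε(A)` -/

variable {ε₀ ε : ℝ}

theorem Development.ell_le {ρ : Annulus → Annulus → ℝ} (D : Development ρ)
    (hρ : ρ ∈ regularMetrics ε₀ ε) : D.ℓ ≤ ε := by
  rw [← D.coreLength_eq]
  exact hρ.2.2.2

/-- The factor `2` is lost only in the upper bound. The sharp lower bound gives `cosh r ≥ ε₀ / ε >
1`, which keeps the collar from degenerating. -/
theorem Development.cosh_r_bounds {ρ : Annulus → Annulus → ℝ} (D : Development ρ)
    (hρ : ρ ∈ regularMetrics ε₀ ε) (hε₀ : 0 < ε₀) :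
    ε₀ ≤ Real.cosh D.r * D.ℓ ∧ Real.cosh D.r * D.ℓ ≤ 2 * ε₀ := by
  obtain ⟨h1, h2⟩ := D.length_circleAt D.sideCoord_right
  rw [hρ.2.2.1] at h1 h2
  have hpos : 0 ≤ Real.cosh D.r * D.ℓ := mul_nonneg (Real.cosh_pos _).le D.ℓ_pos.le
  rw [ENNReal.ofReal_le_ofReal_iff hpos] at h1
  rw [ENNReal.ofReal_le_ofReal_iff hε₀.le] at h2
  exact ⟨h1, by linarith⟩

theorem log_inv_pos (hε : 0 < ε) (hε_one : ε < 1) : 0 < Real.log (1 / ε) :=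
  Real.log_pos (by rw [lt_div_iff₀ hε]; linarith)

theorem log_inv_le_of_le {ℓ : ℝ} (hℓ : 0 < ℓ) (h : ℓ ≤ ε) :
    Real.log (1 / ε) ≤ Real.log (1 / ℓ) :=
  Real.log_le_log (one_div_pos.2 (hℓ.trans_le h)) (one_div_le_one_div_of_le hℓ h)

/-- The width of the collar is comparable to `log (1 / ℓ)`. -/
theorem exists_radius_bound (hε : 0 < ε) (hεε₀ : ε < ε₀) (hε_one : ε < 1) :
    ∃ K : ℝ, 0 < K ∧ ∀ ρ ∈ regularMetrics ε₀ ε, ∀ D : Development ρ,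
      Real.log (1 / D.ℓ) ≤ K * D.r ∧ D.r ≤ K * Real.log (1 / D.ℓ) := by
  have hε₀ := hε.trans hεε₀
  have hlam := log_inv_pos hε hε_one
  have ha : 0 < Real.log ε₀ + Real.log (1 / ε) := by
    rw [one_div, Real.log_inv, ← sub_eq_add_neg, sub_pos]
    exact Real.log_lt_log hε hεε₀
  set lam := Real.log (1 / ε)
  -- Chosen so that `δ * L ≤ log ε₀ + L` for all `L ≥ lam`, even when `log ε₀` is negative; it is
  -- positive because `ε < ε₀`.
  set δ := min 1 ((Real.log ε₀ + lam) / lam) with hδ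
  have hδ0 : 0 < δ := lt_min one_pos (div_pos ha hlam)
  set B := 1 + (Real.log 4 + |Real.log ε₀|) / lam
  have hB : 0 < B := by
    have := Real.log_nonneg (show (1 : ℝ) ≤ 4 by norm_num)
    positivity
  refine ⟨δ⁻¹ + B, by positivity, fun ρ hρ D => ?_⟩
  obtain ⟨h1, h2⟩ := D.cosh_r_bounds hρ hε₀
  have hℓ := D.ℓ_pos
  have hr := D.r_pos
  have hL := log_inv_le_of_le hℓ (D.ell_le hρ)
  have hlog : Real.log (1 / D.ℓ) = -Real.log D.ℓ := by rw [one_div, Real.log_inv]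
  set L := Real.log (1 / D.ℓ)
  have hL0 : 0 < L := hlam.trans_le hL
  have hlow : Real.log ε₀ + L ≤ D.r := by
    have h3 := Real.log_le_log hε₀ h1
    rw [Real.log_mul (Real.cosh_pos _).ne' hℓ.ne'] at h3
    have h4 : Real.cosh D.r ≤ Real.exp D.r := by
      rw [Real.cosh_eq]
      have := Real.exp_le_exp.2 (show -D.r ≤ D.r by linarith)
      linarith
    have h5 := Real.log_le_log (Real.cosh_pos _) h4
    rw [Real.log_exp] at h5
    linarith
  have hup : D.r ≤ Real.log 4 + Real.log ε₀ + L := by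
    have h3 : Real.exp D.r * D.ℓ ≤ 4 * ε₀ := by
      have : Real.exp D.r ≤ 2 * Real.cosh D.r := by
        rw [Real.cosh_eq]
        linarith [Real.exp_pos (-D.r)]
      have := mul_le_mul_of_nonneg_right this hℓ.le
      linarith
    have h4 := Real.log_le_log (by positivity) h3
    rw [Real.log_mul (Real.exp_pos _).ne' hℓ.ne', Real.log_exp,
      Real.log_mul (by norm_num) hε₀.ne'] at h4
    linarith
  constructor
  · have h3 : δ * L ≤ D.r := by
      refine le_trans ?_ hlow
      have h4 : δ * lam ≤ Real.log ε₀ + lam := by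
        rw [← le_div_iff₀ hlam]
        exact min_le_right _ _
      have h5 : δ ≤ 1 := min_le_left _ _
      nlinarith
    rw [add_mul]
    have h4 : L ≤ δ⁻¹ * D.r := by
      rw [inv_mul_eq_div, le_div_iff₀ hδ0]
      linarith
    have := mul_pos hB hr
    linarith
  · rw [add_mul]
    have h4 : D.r ≤ B * L := by
      have h5 : Real.log 4 + |Real.log ε₀| ≤ (Real.log 4 + |Real.log ε₀|) / lam * L := by
        rw [div_mul_eq_mul_div, le_div_iff₀ hlam]
        have := Real.log_nonneg (show (1 : ℝ) ≤ 4 by norm_num)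
        exact mul_le_mul_of_nonneg_left hL (by positivity)
      simp only [B, add_mul, one_mul] at h5 ⊢
      linarith [le_abs_self (Real.log ε₀)]
    have := mul_pos (inv_pos.2 hδ0) hL0
    linarith

/-- Since `cosh r ≥ ε₀ / ε`, one has `tanh² r ≥ 1 - (ε / ε₀)²`, and `tanh r ≥ tanh² r`. -/
theorem exists_tanh_bound (hε : 0 < ε) (hεε₀ : ε < ε₀) :
    ∃ c : ℝ, 0 ≤ c ∧ ∀ ρ ∈ regularMetrics ε₀ ε, ∀ D : Development ρ,
      Real.exp (-c) ≤ Real.sinh D.r / Real.cosh D.r := by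
  have hε₀ := hε.trans hεε₀
  have hq : (ε / ε₀) ^ 2 < 1 := by
    rw [sq_lt_one_iff₀ (by positivity), div_lt_one hε₀]
    exact hεε₀
  refine ⟨-Real.log (1 - (ε / ε₀) ^ 2), ?_, fun ρ hρ D => ?_⟩
  · exact neg_nonneg.2 (Real.log_nonpos (by linarith) (by linarith [sq_nonneg (ε / ε₀)]))
  rw [neg_neg, Real.exp_log (by linarith)]
  have h1 := (D.cosh_r_bounds hρ hε₀).1
  have hc := Real.cosh_pos D.r
  have h2 : ε₀ / ε ≤ Real.cosh D.r := by
    rw [div_le_iff₀ hε]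
    exact h1.trans (mul_le_mul_of_nonneg_left (D.ell_le hρ) hc.le)
  have hs := Real.sinh_nonneg_iff.2 D.r_pos.le
  have hlt := Real.sinh_lt_cosh D.r
  have h3 : 1 / Real.cosh D.r ≤ ε / ε₀ := by
    rw [div_le_div_iff₀ hc hε₀]
    rw [div_le_iff₀ hε] at h2
    linarith
  have h4 : (1 / Real.cosh D.r) ^ 2 ≤ (ε / ε₀) ^ 2 := pow_le_pow_left₀ (by positivity) h3 2
  have h5 : (Real.sinh D.r / Real.cosh D.r) ^ 2 = 1 - (1 / Real.cosh D.r) ^ 2 := by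
    field_simp
    rw [Real.cosh_sq]
    ring
  have h6 : Real.sinh D.r / Real.cosh D.r ≤ 1 := (div_le_one hc).2 hlt.le
  have h7 : 0 ≤ Real.sinh D.r / Real.cosh D.r := div_nonneg hs hc.le
  nlinarith

/-- Up to a uniform additive error, `t ℓ` is the displacement along the axis between the endpoints
of the reference arc. -/
theorem HasTwist.exists_development {ρ : Annulus → Annulus → ℝ}
    {ω : C(unitInterval, Annulus)} {t c : ℝ} (hω : IsReferenceArc ω) (ht : HasTwist ρ ω t)
    (hc : ∀ D : Development ρ, Real.exp (-c) ≤ Real.sinh D.r / Real.cosh D.r) :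
    ∃ (D : Development ρ) (x y : ℝ),
      (∃ w : C(unitInterval, ℝ × unitInterval), (∀ s, cover (w s) = ω s) ∧ w 0 = (x, 0) ∧
        w 1 = (y, 1)) ∧
      |D.ℓ * t - (heightCoord (D.dev (y, 1)) - heightCoord (D.dev (x, 0)))| ≤ 2 * c := by
  obtain ⟨D, w, hw, a, b, ha, hb, h0, h1, rfl⟩ := ht
  have hw0 : w 0 = ((w 0).1, 0) := Prod.ext rfl ((congrArg (fun p : Annulus => p.2) (hw 0)).trans hω.2.1)
  have hw1 : w 1 = ((w 1).1, 1) := Prod.ext rfl ((congrArg (fun p : Annulus => p.2) (hw 1)).trans hω.2.2)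
  refine ⟨D, (w 0).1, (w 1).1, ⟨w, hw, hw0, hw1⟩, ?_⟩
  rw [← mul_div_assoc, sign_mul_dist_idealProj ha hb, D.coreLength_eq,
    mul_div_cancel₀ _ D.ℓ_pos.ne']
  rw [hw0, ← fermi_coords (D.dev _), D.sideCoord_left] at h0
  rw [hw1, ← fermi_coords (D.dev _), D.sideCoord_right] at h1
  exact abs_sub_le_of_sinh_eq (sinh_half_eq_of_mem_geodesic ha hb h0 h1)
    ((div_le_one (Real.cosh_pos _)).2 (Real.sinh_lt_cosh _).le) (hc D)

/-- The length of the arc that winds `n` times relative to the reference arc is comparable to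
`log (1 / ℓ) + ℓ |n + t|`. -/
theorem exists_arcLength_bound (hε : 0 < ε) (hεε₀ : ε < ε₀) (hε_one : ε < 1) :
    ∃ K : ℝ, 1 ≤ K ∧ ∀ (ω : C(unitInterval, Annulus)), IsReferenceArc ω →
      ∀ w : C(unitInterval, ℝ × unitInterval), (∀ s, cover (w s) = ω s) →
      ∀ ρ ∈ regularMetrics ε₀ ε, ∀ t, HasTwist ρ ω t →
      ∀ (β : C(unitInterval, Annulus)) (v : C(unitInterval, ℝ × unitInterval)) (x y : ℝ),
        (∀ s, cover (v s) = β s) →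
        (v 0 = (x, 0) ∧ v 1 = (y, 1) ∨ v 0 = (y, 1) ∧ v 1 = (x, 0)) →
        Real.log (1 / coreLength ρ) + coreLength ρ * |(y - x) - ((w 1).1 - (w 0).1) + t| ≤
          K * arcLength ρ β ∧
        arcLength ρ β ≤ K * (Real.log (1 / coreLength ρ) +
          coreLength ρ * |(y - x) - ((w 1).1 - (w 0).1) + t|) := by
  obtain ⟨K, hK, hr⟩ := exists_radius_bound hε hεε₀ hε_one
  obtain ⟨c, hc, hτ⟩ := exists_tanh_bound hε hεε₀
  have hlam := log_inv_pos hε hε_one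
  set lam := Real.log (1 / ε)
  -- The `3` comes from the path through the axis. The terms with `(2 * c + 2) / lam` absorb the
  -- additive error `2 * c + 2` into a multiple of `log (1 / ℓ) ≥ lam`.
  refine ⟨3 * (K + 1 + (2 * c + 2) / lam + (2 * c + 2) / lam * K), ?_, ?_⟩
  · have : 0 ≤ (2 * c + 2) / lam := by positivity
    nlinarith [mul_nonneg this hK.le]
  intro ω hω w hw ρ hρ t ht β v x y hv hends
  obtain ⟨D, x₀, y₀, ⟨w', hw', hw'0, hw'1⟩, hD⟩ := ht.exists_development hω (hτ ρ hρ)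
  -- The lift used for the twist may differ from `w`, but only by a deck transformation, which
  -- cancels in the difference of endpoints.
  obtain ⟨n, hn⟩ := exists_int_of_lifts w.continuous w'.continuous fun s => by rw [hw, hw']
  have hshift : (w 1).1 - (w 0).1 = y₀ - x₀ := by
    have h0 := congrArg Prod.fst (hn 0)
    have h1 := congrArg Prod.fst (hn 1)
    rw [hw'0] at h0
    rw [hw'1] at h1
    simp only at h0 h1
    linarith
  obtain ⟨hr1, hr2⟩ := hr ρ hρ D
  have hx := D.abs_height_sub_le D.sideCoord_left x x₀
  have hy := D.abs_height_sub_le D.sideCoord_right y y₀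
  have hℓ1 : D.ℓ ≤ 1 := (D.ell_le hρ).trans hε_one.le
  have hℓ := D.ℓ_pos
  have hL := log_inv_le_of_le hℓ (D.ell_le hρ)
  -- The twist contributes `2 * c` and each boundary component at most `ℓ ≤ 1`.
  have hd : |D.ℓ * ((y - x) - (y₀ - x₀) + t) -
      (heightCoord (D.dev (y, 1)) - heightCoord (D.dev (x, 0)))| ≤ 2 * c + 2 := by
    rw [abs_le] at hx hy hD ⊢
    constructor <;> linarith [hx.1, hx.2, hy.1, hy.2, hD.1, hD.2]
  have hlen : |heightCoord (D.dev (y, 1)) - heightCoord (D.dev (x, 0))| ≤ arcLength ρ β ∧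
      D.r ≤ arcLength ρ β ∧ arcLength ρ β ≤
        3 * (D.r + |heightCoord (D.dev (y, 1)) - heightCoord (D.dev (x, 0))|) := by
    have hle := D.arcLength_le hv
    have hge := D.le_arcLength hv
    have h1 := (abs_heightCoord_sub_le_dist _ _).trans hge
    have h2 := (abs_sideCoord_sub_le_dist _ _).trans hge
    have hr := D.r_pos
    rcases hends with ⟨h, h'⟩ | ⟨h, h'⟩
    · rw [h, h'] at hle h1 h2
      rw [D.sideCoord_left, D.sideCoord_right, abs_sub_comm, abs_of_pos (by linarith)] at h2
      rw [abs_sub_comm] at hle h1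
      exact ⟨h1, by linarith, hle⟩
    · rw [h, h'] at hle h1 h2
      rw [D.sideCoord_left, D.sideCoord_right, abs_of_pos (by linarith)] at h2
      exact ⟨h1, by linarith, hle⟩
  obtain ⟨hl1, hl2, hl3⟩ := hlen
  rw [D.coreLength_eq, hshift]
  have habs : D.ℓ * |(y - x) - (y₀ - x₀) + t| = |D.ℓ * ((y - x) - (y₀ - x₀) + t)| := by
    rw [abs_mul, abs_of_pos hℓ]
  rw [habs]
  have hm := abs_le.1 ((abs_abs_sub_abs_le _ _).trans hd)
  set L := Real.log (1 / D.ℓ)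
  set m := |D.ℓ * ((y - x) - (y₀ - x₀) + t)|
  set d := |heightCoord (D.dev (y, 1)) - heightCoord (D.dev (x, 0))|
  have hm0 : 0 ≤ m := abs_nonneg _
  have hd0 : 0 ≤ d := abs_nonneg _
  have hL0 : 0 < L := hlam.trans_le hL
  have hA0 : 0 ≤ arcLength ρ β := hd0.trans hl1
  have hq : 0 ≤ (2 * c + 2) / lam := by positivity
  have hq1 : 2 * c + 2 ≤ (2 * c + 2) / lam * L := by
    rw [div_mul_eq_mul_div, le_div_iff₀ hlam]
    exact mul_le_mul_of_nonneg_left hL (by positivity)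
  generalize (2 * c + 2) / lam = q at *
  constructor
  · have h1 : L ≤ K * arcLength ρ β := hr1.trans (mul_le_mul_of_nonneg_left hl2 hK.le)
    have h2 := mul_le_mul_of_nonneg_left h1 hq
    have h3 := mul_nonneg hq hA0
    have h4 := mul_nonneg (mul_nonneg hq hK.le) hA0
    have h5 := mul_nonneg hK.le hA0
    nlinarith [hm.2]
  · have h3 := mul_nonneg hq hL0.le
    have h4 := mul_nonneg (mul_nonneg hq hK.le) hL0.le
    have h5 := mul_nonneg hK.le hm0
    have h6 := mul_nonneg hq hm0
    have h7 := mul_nonneg (mul_nonneg hq hK.le) hm0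
    nlinarith [hm.1]

/-! ### Comparison of two regular metrics -/

theorem abs_log_div_le {x y C : ℝ} (hx : 0 < x) (hy : 0 < y) (h1 : x ≤ C * y) (h2 : y ≤ C * x) :
    |Real.log (x / y)| ≤ Real.log C := by
  have hC : 0 < C := pos_of_mul_pos_left (hx.trans_le h1) hy.le
  rw [Real.log_div hx.ne' hy.ne', abs_le]
  have h3 := Real.log_le_log hx h1
  have h4 := Real.log_le_log hy h2
  rw [Real.log_mul hC.ne' hy.ne'] at h3
  rw [Real.log_mul hC.ne' hx.ne'] at h4
  constructor <;> linarith

/-- The elementary inequalities behind the comparison of the lengths of an arc in two metrics,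
with `A` and `B` the absolute values of its windings and `Δ` the difference of the twists. -/
theorem comparison_aux {lam l₁ l₂ A B Δ R : ℝ} (hlam : 0 < lam) (h₁ : 0 < l₁) (h₁₂ : l₁ ≤ l₂)
    (hL₂ : lam ≤ Real.log (1 / l₂)) (hA : 0 ≤ A) (hB : 0 ≤ B) (hAB : A ≤ B + Δ)
    (hBA : B ≤ A + Δ) (hR : l₂ / l₁ ≤ R) (hR' : Δ * l₂ / Real.log (1 / l₁) ≤ R) :
    Real.log (1 / l₁) + l₁ * A ≤
        (2 + 2 / lam) * R * (Real.log (1 / l₂) + l₂ * B) ∧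
      Real.log (1 / l₂) + l₂ * B ≤
        (2 + 2 / lam) * R * (Real.log (1 / l₁) + l₁ * A) := by
  have h₂ := h₁.trans_le h₁₂
  have hL₁₂ : Real.log (1 / l₂) ≤ Real.log (1 / l₁) := log_inv_le_of_le h₁ h₁₂
  have hsub : Real.log (1 / l₁) = Real.log (1 / l₂) + Real.log (l₂ / l₁) := by
    rw [← Real.log_mul (by positivity) (by positivity)]
    congr 1
    field_simp
  have hle : Real.log (l₂ / l₁) ≤ l₂ / l₁ :=
    (Real.log_le_sub_one_of_pos (by positivity)).trans (by linarith)
  have hq1 : 1 ≤ l₂ / l₁ := (one_le_div h₁).2 h₁₂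
  set L₁ := Real.log (1 / l₁)
  set L₂ := Real.log (1 / l₂)
  set q := l₂ / l₁
  have hql : l₂ = q * l₁ := (div_mul_cancel₀ _ h₁.ne').symm
  have hL₂0 : 0 < L₂ := hlam.trans_le hL₂
  have hL₁0 : 0 < L₁ := hL₂0.trans_le hL₁₂
  -- `L₁ = L₂ + log q` with `log q ≤ q`, and `L₂ ≥ lam` turns the added `q` into a multiple of `q *
  -- L₂`.
  have hk : L₁ ≤ (1 + 1 / lam) * q * L₂ := by
    have h1 : 1 ≤ 1 / lam * L₂ := by rwa [one_div_mul_eq_div, one_le_div hlam]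
    have h2 := mul_le_mul_of_nonneg_left h1 (zero_le_one.trans hq1)
    have h3 := mul_le_mul_of_nonneg_right hq1 hL₂0.le
    linarith
  have hm : 0 < 1 + 1 / lam := by positivity
  rw [show 2 + 2 / lam = 2 * (1 + 1 / lam) by ring]
  set m := 1 + 1 / lam
  have hm1 : 1 ≤ m := by
    have : 0 < 1 / lam := by positivity
    simp only [m]
    linarith
  have hR1 : 1 ≤ R := hq1.trans hR
  have hΔ : Δ * l₂ ≤ R * L₁ := (div_le_iff₀ hL₁0).1 hR'
  have hmR : R ≤ m * R := le_mul_of_one_le_left (by linarith) hm1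
  constructor
  · have e1 : L₁ ≤ m * R * L₂ := hk.trans
      (mul_le_mul_of_nonneg_right (mul_le_mul_of_nonneg_left hR hm.le) hL₂0.le)
    have e2 : l₁ * Δ ≤ m * R * L₂ := by
      have h1 : q * (l₁ * Δ) ≤ q * (m * R * L₂) := by
        calc q * (l₁ * Δ) = Δ * l₂ := by rw [hql]; ring
          _ ≤ R * L₁ := hΔ
          _ ≤ R * (m * q * L₂) := mul_le_mul_of_nonneg_left hk (by linarith)
          _ = q * (m * R * L₂) := by ring
      exact le_of_mul_le_mul_left h1 (by linarith)
    have e3 : l₁ * B ≤ m * R * (l₂ * B) := by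
      have h1 : l₁ * B ≤ l₂ * B := mul_le_mul_of_nonneg_right h₁₂ hB
      exact h1.trans (le_mul_of_one_le_left (by positivity) (hR1.trans hmR))
    have e4 := mul_le_mul_of_nonneg_left hAB h₁.le
    have e5 : 0 ≤ m * R * (l₂ * B) := by positivity
    linarith
  · have e1 : L₁ ≤ m * R * L₁ := le_mul_of_one_le_left hL₁0.le (hR1.trans hmR)
    have e2 : R * L₁ ≤ m * R * L₁ := mul_le_mul_of_nonneg_right hmR hL₁0.le
    have e3 : l₂ * A ≤ m * R * (l₁ * A) := by
      rw [hql, mul_assoc]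
      exact mul_le_mul_of_nonneg_right (hR.trans hmR) (by positivity)
    have e4 := mul_le_mul_of_nonneg_left hBA h₂.le
    have e5 : 0 ≤ m * R * (l₁ * A) := by positivity
    linarith

theorem IsEssentialArc.exists_lift {β : C(unitInterval, Annulus)} (hβ : IsEssentialArc β) :
    ∃ (v : C(unitInterval, ℝ × unitInterval)) (x y : ℝ), (∀ s, cover (v s) = β s) ∧
      (v 0 = (x, 0) ∧ v 1 = (y, 1) ∨ v 0 = (y, 1) ∧ v 1 = (x, 0)) := by
  obtain ⟨v, hv⟩ := exists_lift_path β
  have hsnd : ∀ s, (v s).2 = (β s).2 := fun s => congrArg (fun p : Annulus => p.2) (hv s)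
  rcases hβ.endpoints with ⟨h0, h1⟩ | ⟨h0, h1⟩
  · exact ⟨v, (v 0).1, (v 1).1, hv, .inl ⟨Prod.ext rfl ((hsnd 0).trans h0),
      Prod.ext rfl ((hsnd 1).trans h1)⟩⟩
  · exact ⟨v, (v 1).1, (v 0).1, hv, .inr ⟨Prod.ext rfl ((hsnd 0).trans h0),
      Prod.ext rfl ((hsnd 1).trans h1)⟩⟩

theorem log_coreLength_mem_logRatios {ρ₁ ρ₂ : Annulus → Annulus → ℝ} :
    |Real.log (coreLength ρ₁ / coreLength ρ₂)| ∈ logRatios ρ₁ ρ₂ :=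
  .inr ⟨_, isEssentialLoop_circleAt _, rfl⟩

theorem loopLength_div_loopLength {ρ₁ ρ₂ : Annulus → Annulus → ℝ} (D₁ : Development ρ₁)
    (D₂ : Development ρ₂) {f : C(UnitAddCircle, Annulus)} (hf : IsEssentialLoop f) :
    loopLength ρ₁ f / loopLength ρ₂ f = coreLength ρ₁ / coreLength ρ₂ := by
  obtain ⟨F, k, hF⟩ := exists_isLoopLift f
  have hk : |(k : ℝ)| ≠ 0 := abs_ne_zero.2 (Int.cast_ne_zero.2 (hF.degree_ne_zero hf.2))
  rw [D₁.loopLength_eq hF, D₂.loopLength_eq hF, D₁.coreLength_eq, D₂.coreLength_eq,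
    mul_div_mul_left _ _ hk]

end Annular
end

theorem mainTheorem8 (ε₀ ε : ℝ) (hε : 0 < ε) (hεε₀ : ε < ε₀) (hε_one : ε < 1) :
    ∃ c : ℝ, ∀ ω : C(unitInterval, Annular.Annulus), Annular.IsReferenceArc ω →
      ∀ ρ₁ ∈ Annular.regularMetrics ε₀ ε, ∀ ρ₂ ∈ Annular.regularMetrics ε₀ ε,
      ∀ t₁ t₂ l₁ l₂ : ℝ, Annular.HasTwist ρ₁ ω t₁ → Annular.HasTwist ρ₂ ω t₂ →
        l₁ = Annular.coreLength ρ₁ → l₂ = Annular.coreLength ρ₂ → l₁ ≤ l₂ →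
        BddAbove (Annular.logRatios ρ₁ ρ₂) ∧
        (|t₁ - t₂| * l₁ ≤ Real.log (1 / l₁) →
          |Annular.lipDist ρ₁ ρ₂ - Real.log (l₂ / l₁)| ≤ c) ∧
        (Real.log (1 / l₁) < |t₁ - t₂| * l₁ →
          |Annular.lipDist ρ₁ ρ₂ - Real.log (|t₁ - t₂| * l₂ / Real.log (1 / l₁))| ≤ c ∧
          Real.log (|t₁ - t₂| * l₂ / Real.log (1 / l₁)) =
            Real.log (l₂ / l₁) + Real.log (|t₁ - t₂| * l₁ / Real.log (1 / l₁))) := by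
  open Annular in
  obtain ⟨K, hK, harc⟩ := exists_arcLength_bound hε hεε₀ hε_one
  have hlam := log_inv_pos hε hε_one
  set lam := Real.log (1 / ε)
  have hK0 : 0 < K := by linarith
  have hC : 1 ≤ 2 + 2 / lam := by
    have : 0 < 2 / lam := by positivity
    linarith
  have hCK : 1 ≤ K ^ 2 * (2 + 2 / lam) := by nlinarith
  -- One factor `K` comes from the length estimate in each metric, and `2 + 2 / lam` from
  -- `comparison_aux`.
  refine ⟨Real.log (K ^ 2 * (2 + 2 / lam)), ?_⟩
  intro ω hω ρ₁ hρ₁ ρ₂ hρ₂ t₁ t₂ l₁ l₂ ht₁ ht₂ hl₁ hl₂ h₁₂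
  obtain ⟨D₁⟩ := hρ₁.1
  obtain ⟨D₂⟩ := hρ₂.1
  obtain ⟨w, hw⟩ := exists_lift_path ω
  have h₁ : 0 < l₁ := by rw [hl₁, D₁.coreLength_eq]; exact D₁.ℓ_pos
  have h₂ : 0 < l₂ := h₁.trans_le h₁₂
  have hL₂ : lam ≤ Real.log (1 / l₂) := log_inv_le_of_le h₂ (hl₂ ▸ hρ₂.2.2.2)
  have hL₁ : 0 < Real.log (1 / l₁) := hlam.trans_le (hL₂.trans (log_inv_le_of_le h₁ h₁₂))
  have harc₁ := harc ω hω w hw ρ₁ hρ₁ t₁ ht₁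
  have harc₂ := harc ω hω w hw ρ₂ hρ₂ t₂ ht₂
  rw [← hl₁] at harc₁
  rw [← hl₂] at harc₂
  have hq1 : 1 ≤ l₂ / l₁ := (one_le_div h₁).2 h₁₂
  have hcore : |Real.log (coreLength ρ₁ / coreLength ρ₂)| = Real.log (l₂ / l₁) := by
    rw [← hl₁, ← hl₂, ← inv_div, Real.log_inv, abs_neg, abs_of_nonneg (Real.log_nonneg hq1)]
  -- One estimate serves three times: `R` will be the maximum of the two quotients for boundedness,
  -- the first quotient in case (i) and the second in case (ii).
  have hupper : ∀ R, l₂ / l₁ ≤ R → |t₁ - t₂| * l₂ / Real.log (1 / l₁) ≤ R →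
      ∀ x ∈ logRatios ρ₁ ρ₂, x ≤ Real.log R + Real.log (K ^ 2 * (2 + 2 / lam)) := by
    rintro R hR hR' x (⟨β, hβ, rfl⟩ | ⟨f, hf, rfl⟩)
    · obtain ⟨v, x, y, hv, hends⟩ := hβ.exists_lift
      obtain ⟨a1, a2⟩ := harc₁ β v x y hv hends
      obtain ⟨b1, b2⟩ := harc₂ β v x y hv hends
      set n := (y - x) - ((w 1).1 - (w 0).1)
      have hAB : |n + t₁| ≤ |n + t₂| + |t₁ - t₂| := by
        have := abs_add_le (n + t₂) (t₁ - t₂)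
        rwa [show n + t₂ + (t₁ - t₂) = n + t₁ by ring] at this
      have hBA : |n + t₂| ≤ |n + t₁| + |t₁ - t₂| := by
        rw [abs_sub_comm t₁]
        have := abs_add_le (n + t₁) (t₂ - t₁)
        rwa [show n + t₁ + (t₂ - t₁) = n + t₂ by ring] at this
      obtain ⟨c1, c2⟩ := comparison_aux hlam h₁ h₁₂ hL₂ (abs_nonneg _) (abs_nonneg _) hAB hBA
        hR hR'
      have hM₁ : 0 < Real.log (1 / l₁) + l₁ * |n + t₁| :=
        add_pos_of_pos_of_nonneg hL₁ (by positivity)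
      have hM₂ : 0 < Real.log (1 / l₂) + l₂ * |n + t₂| :=
        add_pos_of_pos_of_nonneg (hlam.trans_le hL₂) (by positivity)
      have hA₁ : 0 < arcLength ρ₁ β := pos_of_mul_pos_right (hM₁.trans_le a1) hK0.le
      have hA₂ : 0 < arcLength ρ₂ β := pos_of_mul_pos_right (hM₂.trans_le b1) hK0.le
      have hR0 : 0 < R := by linarith
      have hCR : 0 ≤ K * ((2 + 2 / lam) * R) := by positivity
      rw [add_comm, ← Real.log_mul (by positivity) hR0.ne']
      refine abs_log_div_le hA₁ hA₂ ?_ ?_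
      · have := mul_le_mul_of_nonneg_left c1 hK0.le
        have := mul_le_mul_of_nonneg_left b1 hCR
        linarith
      · have := mul_le_mul_of_nonneg_left c2 hK0.le
        have := mul_le_mul_of_nonneg_left a1 hCR
        linarith
    · rw [loopLength_div_loopLength D₁ D₂ hf, hcore]
      linarith [Real.log_le_log (by positivity) hR, Real.log_nonneg hCK]
  have hne : (logRatios ρ₁ ρ₂).Nonempty := ⟨_, log_coreLength_mem_logRatios⟩
  have hbdd : BddAbove (logRatios ρ₁ ρ₂) :=
    ⟨_, hupper _ (le_max_left _ _) (le_max_right _ _)⟩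
  have hsup : ∀ R, l₂ / l₁ ≤ R → |t₁ - t₂| * l₂ / Real.log (1 / l₁) ≤ R →
      lipDist ρ₁ ρ₂ ≤ Real.log R + Real.log (K ^ 2 * (2 + 2 / lam)) := fun R hR hR' =>
    csSup_le hne (hupper R hR hR')
  refine ⟨hbdd, fun h => ?_, fun h => ?_⟩
  · have hlow : Real.log (l₂ / l₁) ≤ lipDist ρ₁ ρ₂ := by
      rw [← hcore]
      exact le_csSup hbdd log_coreLength_mem_logRatios
    have hR' : |t₁ - t₂| * l₂ / Real.log (1 / l₁) ≤ l₂ / l₁ := by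
      rw [div_le_div_iff₀ hL₁ h₁]
      have := mul_le_mul_of_nonneg_left h h₂.le
      linarith
    rw [abs_le]
    constructor
    · linarith [Real.log_nonneg hCK]
    · linarith [hsup _ le_rfl hR']
  · have hΔ : 0 < |t₁ - t₂| := pos_of_mul_pos_left (hL₁.trans h) h₁.le
    have hR : l₂ / l₁ ≤ |t₁ - t₂| * l₂ / Real.log (1 / l₁) := by
      rw [div_le_div_iff₀ h₁ hL₁]
      have := mul_le_mul_of_nonneg_left h.le h₂.le
      linarith
    constructor
    · have hlow : Real.log (|t₁ - t₂| * l₂ / Real.log (1 / l₁)) ≤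
          lipDist ρ₁ ρ₂ + Real.log (K ^ 2) := by
        -- This straight arc has winding exactly `-t₁` relative to `ω`. The endpoints on the
        -- boundary are free, so `t₁` need not be rounded to an integer.
        set y := (w 1).1 - (w 0).1 - t₁
        have hmem := le_csSup hbdd (.inl ⟨_, isEssentialArc_straightArc 0 y, rfl⟩)
        have hends : straightLift 0 y 0 = (0, 0) ∧ straightLift 0 y 1 = (y, 1) := by
          simp [straightLift]
        obtain ⟨a1, a2⟩ := harc₁ (straightArc 0 y) (straightLift 0 y) 0 y (fun _ => rfl) (.inl hends)
        obtain ⟨b1, b2⟩ := harc₂ (straightArc 0 y) (straightLift 0 y) 0 y (fun _ => rfl) (.inl hends)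
        have e1 : y - 0 - ((w 1).1 - (w 0).1) + t₁ = 0 := by simp only [y]; ring
        have e2 : y - 0 - ((w 1).1 - (w 0).1) + t₂ = -(t₁ - t₂) := by simp only [y]; ring
        rw [e1, abs_zero, mul_zero, add_zero] at a1 a2
        rw [e2, abs_neg] at b1 b2
        have hA₁ := pos_of_mul_pos_right (hL₁.trans_le a1) hK0.le
        have hM₂ : |t₁ - t₂| * l₂ ≤ K * arcLength ρ₂ (straightArc 0 y) := by linarith
        have hA₂ := pos_of_mul_pos_right ((mul_pos hΔ h₂).trans_le hM₂) hK0.le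
        have hle : |t₁ - t₂| * l₂ / Real.log (1 / l₁) ≤
            arcLength ρ₂ (straightArc 0 y) / arcLength ρ₁ (straightArc 0 y) * K ^ 2 := by
          rw [div_mul_eq_mul_div, div_le_div_iff₀ hL₁ hA₁]
          have := mul_le_mul hM₂ a2 hA₁.le (by positivity)
          linarith
        have hlog := Real.log_le_log (by positivity) hle
        rw [Real.log_mul (by positivity) (by positivity), ← inv_div (arcLength ρ₁ _), Real.log_inv] at hlog
        have := neg_le_abs (Real.log
          (arcLength ρ₁ (straightArc 0 y) / arcLength ρ₂ (straightArc 0 y)))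
        rw [lipDist]
        linarith
      have hKC : Real.log (K ^ 2) ≤ Real.log (K ^ 2 * (2 + 2 / lam)) :=
        Real.log_le_log (by positivity) (le_mul_of_one_le_right (by positivity) hC)
      rw [abs_le]
      constructor
      · linarith
      · linarith [hsup _ hR le_rfl]
    · rw [← Real.log_mul (by positivity) (by positivity)]
      congr 1
      field_simp
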